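/- Notation. Boxes are taken in the sup norm of $\mathbb Z^2$: $\mathbf B(x,\rho)=\{y\in\mathbb Z^2:\|x-y\|\le\rho\}$. For $l\in\mathbb N$, $l\ge 1$, let $\mathbb Z^2_l=(2l+1)\mathbb Z^2$ with its nearest-neighbour structure, and for $r\in\mathbb R$ let $\mathbf B^l(0,r)=\{y\in\mathbb Z^2_l:\|y\|\le lr\}$, with outer boundary $\partial\mathbf B^l(0,r)$ (the points of $\mathbb Z_l^2$ outside the box that have a $\mathbb Z^2_l$-neighbour in it). For $\epsilon\in(0,1)$, a set $A\subset\mathbb Z^2$ is called $(r,\epsilon)$-clean if there is a nearest-neighbour path $\gamma$ of $\mathbb Z^2_l$ from the origin to $\partial\mathbf B^l(0,r)$ such that $\#\{x\in\gamma:\mathbf B(x,l)\cap A\ne\emptyset\}<\epsilon r$; otherwise $A$ is $(r,\epsilon)$-dirty. For a process $X$ on $\mathbb Z^2$ started at $0$ let $\tau_A=\inf\{t:X(t)\in A\}$ and $\tau_{rl}=\inf\{t:X(t)\notin\mathbf B(0,rl)\}$ (with $\inf\emptyset=\infty$). Proposition. For every $\epsilon\in(0,1)$ there is $r_0=r_0(\epsilon)$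 such that for every $l\ge1$ and every $c_V\ge1$ there is a constant $c_3=c_3(\epsilon,l,c_V)>0$ with the following property. Let $r\ge r_0$ and let $A\subset\mathbb Z^2$ be $(r,\epsilon)$-dirty. (1) Suppose that $A^c=\mathbb Z^2\setminus A$ is finite. Let $V:\mathbb R\to\mathbb R$ be even and smooth with $1/c_V\le V''\le c_V$, and let $\phi\in\mathbb R^{A^c}$. Let $\Phi$ be the Langevin diffusion on $\mathbb R^{A^c}$ started at $\phi$, $$d\Phi_x=-\sum_{y\sim x}V'(\Phi_x-\Phi_y)\,dt+\sqrt2\,dB_x\quad(x\in A^c),\qquad \Phi_y\equiv0\quad (y\in A),$$ where the $B_x$ are independent standard Brownian motions, and, given the trajectory of $\Phi$, let $X$ be the nearest-neighbour random walk on $\mathbb Z^2$ started at $0$ and killed on $A$ with the jump rates $a(i,j;t)=V''(\Phi_i(t)-\Phi_j(t))$ for $i\sim j$. Then the law $\mathcal E^A_{0,\phi}$ of $(X,\Phi)$ satisfies $$\mathcal E^A_{0,\phi}(\tau_A>\tau_{rl})\le e^{-c_3rl}.$$ (2) The same bound $\mathbb P(\tau_A>\tau_{rl})\le e^{-c_3rl}$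 holds, with no finiteness assumption on $A^c$, for every time-inhomogeneous nearest-neighbour random walk $X$ started at $0$ and killed on $A$ with deterministic, measurable jump rates $1/c_V\le a(i,j;t)\le c_V$ for all $i\sim j$ and $t\ge0$. In particular the bound is uniform in $r\ge r_0$, in the $(r,\epsilon)$-dirty set $A$, in the potential $V$ and in the initial field $\phi$. -/

import Mathlib

open MeasureTheory ProbabilityTheory
open scoped NNReal ENNReal

noncomputable section

namespace PinnedField

/-! ### Geometry of the lattice and of the renormalized lattice -/

/-- The four nearest neighbours of a site of `ℤ²`. -/
def nbrs (i : ℤ × ℤ) : Finset (ℤ × ℤ) :=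
  {(i.1 + 1, i.2), (i.1 - 1, i.2), (i.1, i.2 + 1), (i.1, i.2 - 1)}

/-- The box `B(x, ρ) = {y ∈ ℤ² : ‖x - y‖ ≤ ρ}`. The norm of `ℤ × ℤ` is the sup norm. -/
def box (x : ℤ × ℤ) (ρ : ℝ) : Set (ℤ × ℤ) := {y | ‖x - y‖ ≤ ρ}

/-- The renormalized lattice `ℤ²_l = (2l+1) ℤ²`. -/
def renLattice (l : ℕ) : Set (ℤ × ℤ) :=
  {x | (2 * (l : ℤ) + 1) ∣ x.1 ∧ (2 * (l : ℤ) + 1) ∣ x.2}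

/-- The nearest-neighbour graph of `ℤ²_l`: two of its points are neighbours if they are at
`ℓ¹`-distance exactly `2l+1`. -/
def renGraph (l : ℕ) : SimpleGraph (ℤ × ℤ) where
  Adj x y := x ∈ renLattice l ∧ y ∈ renLattice l ∧
    |x.1 - y.1| + |x.2 - y.2| = 2 * (l : ℤ) + 1
  symm := ⟨fun x y h => ⟨h.2.1, h.1, by
    rw [abs_sub_comm y.1, abs_sub_comm y.2]; exact h.2.2⟩⟩
  loopless := ⟨fun x h => by
    have h2 := h.2.2
    simp only [sub_self, abs_zero, add_zero] at h2
    omega⟩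

/-- The box `B^l(x, r) = {y ∈ ℤ²_l : ‖x - y‖ ≤ l r}` of the renormalized lattice. -/
def renBox (l : ℕ) (x : ℤ × ℤ) (r : ℝ) : Set (ℤ × ℤ) :=
  {y | y ∈ renLattice l ∧ ‖x - y‖ ≤ l * r}

/-- The (outer) boundary of `B^l(x, r)` in the renormalized lattice. -/
def renBoundary (l : ℕ) (x : ℤ × ℤ) (r : ℝ) : Set (ℤ × ℤ) :=
  {y | y ∉ renBox l x r ∧ ∃ z ∈ renBox l x r, (renGraph l).Adj z y}

/-- `A` is `(r, ε)`-clean at scale `l`: some nearest-neighbour path of `ℤ²_l` leading from the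
origin to the boundary of `B^l(0, r)` visits fewer than `ε r` vertices `x` whose block
`B(x, l)` meets `A`. -/
def IsClean (l : ℕ) (r ε : ℝ) (A : Set (ℤ × ℤ)) : Prop :=
  ∃ y ∈ renBoundary l 0 r, ∃ γ : (renGraph l).Walk 0 y,
    ({x | x ∈ γ.support ∧ (box x l ∩ A).Nonempty}.ncard : ℝ) < ε * r

/-- `A` is `(r, ε)`-dirty at scale `l` if it is not `(r, ε)`-clean. -/
def IsDirty (l : ℕ) (r ε : ℝ) (A : Set (ℤ × ℤ)) : Prop := ¬ IsClean l r ε A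

/-! ### Random walks with time-dependent rates, killed on `A` -/

/-- The generator, with jump rates `a i j`, of the nearest-neighbour walk killed on `A`: the walk
stays for ever at the site of `A` at which it has been killed. -/
def killedGen (A : Set (ℤ × ℤ)) (a : ℤ × ℤ → ℤ × ℤ → ℝ) (f : ℤ × ℤ → ℝ) (i : ℤ × ℤ) : ℝ :=
  open Classical in if i ∈ A then 0 else ∑ j ∈ nbrs i, a i j * (f j - f i)

variable {Ω : Type*} {mΩ : MeasurableSpace Ω}

/-- `X` is, with respect to the filtration `ℱ`, the random walk on `ℤ²` started at `i₀` and killed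
on `A`, whose jump rate from `i` to a neighbour `j` at time `t` is `a t ω i j` (the rates may
depend on `ω` through a random environment). It is a càdlàg process (in the discrete
space `ℤ²`) that solves the martingale problem of the time-dependent generator on bounded
functions. -/
structure IsKilledWalk (A : Set (ℤ × ℤ)) (a : ℝ≥0 → Ω → ℤ × ℤ → ℤ × ℤ → ℝ) (i₀ : ℤ × ℤ)
    (ℱ : Filtration ℝ≥0 mΩ) (X : ℝ≥0 → Ω → ℤ × ℤ) (P : Measure Ω) : Prop where
  adapted : ∀ t, Measurable[ℱ t] (X t)
  right_cont : ∀ ω t, ∀ᶠ s in nhdsWithin t (Set.Ici t), X s ω = X t ω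
  left_lim : ∀ ω t, ∃ k, ∀ᶠ s in nhdsWithin t (Set.Iio t), X s ω = k
  start : ∀ᵐ ω ∂P, X 0 ω = i₀
  martingale : ∀ f : ℤ × ℤ → ℝ, (∃ C, ∀ i, |f i| ≤ C) →
    Martingale (fun t ω => f (X t ω) -
      ∫ s in (0 : ℝ)..(t : ℝ), killedGen A (a s.toNNReal ω) f (X s.toNNReal ω)) ℱ P

/-! ### The Helffer–Sjöstrand process -/

/-- The extension of a field on `Aᶜ` to `ℤ²` by the boundary condition `0` on `A`. -/
def extendZero (A : Set (ℤ × ℤ)) (φ : ↥Aᶜ → ℝ) : ℤ × ℤ → ℝ := Function.extend Subtype.val φ 0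

/-- `Φ` is the Langevin diffusion on `ℝ^(Aᶜ)` with Hamiltonian `H(φ) = ∑_{i ∼ j} V(φ_i - φ_j)`,
zero boundary conditions on `A` and initial field `φ`:
`dΦ_x = - ∑_{y ∼ x} V'(Φ_x - Φ_y) dt + √2 dB_x` for `x ∉ A`, with independent standard Brownian
motions `B_x`. For even `V` the drift is `-∂H/∂φ_x`, so the Gibbs measure with density
proportional to `exp(-H)` is invariant. -/
structure IsLangevin (V : ℝ → ℝ) (A : Set (ℤ × ℤ)) (φ : ↥Aᶜ → ℝ)
    (Φ : ℝ≥0 → Ω → (↥Aᶜ → ℝ)) (P : Measure Ω) : Prop where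
  measurable : ∀ t, Measurable (Φ t)
  continuous_paths : ∀ ω, Continuous fun t => Φ t ω
  sde : ∃ B : ↥Aᶜ → ℝ≥0 → Ω → ℝ,
    (∀ x, IsBrownianReal (B x) P) ∧
    iIndepFun (fun x ω t => B x t ω) P ∧
    ∀ᵐ ω ∂P, ∀ t x, Φ t ω x = φ x
      - (∫ s in (0 : ℝ)..(t : ℝ), ∑ y ∈ nbrs x,
          deriv V (extendZero A (Φ s.toNNReal ω) x - extendZero A (Φ s.toNNReal ω) y))
      + √2 * B x t ω

/-- `(X, Φ)` is the process with law `𝓔^A_{i₀, φ}`: `Φ` is the Langevin diffusion started at `φ`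
and, given the whole trajectory of `Φ` (which is known to the filtration at time `0`), `X` is the
random walk started at `i₀` and killed on `A` with jump rates `V''(Φ_i(t) - Φ_j(t))`. -/
structure IsHSProcess (V : ℝ → ℝ) (A : Set (ℤ × ℤ)) (i₀ : ℤ × ℤ) (φ : ↥Aᶜ → ℝ)
    (X : ℝ≥0 → Ω → ℤ × ℤ) (Φ : ℝ≥0 → Ω → (↥Aᶜ → ℝ)) (P : Measure Ω) : Prop where
  langevin : IsLangevin V A φ Φ P
  walk : ∃ ℱ : Filtration ℝ≥0 mΩ, (∀ t, Measurable[ℱ 0] (Φ t)) ∧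
    IsKilledWalk A
      (fun t ω i j => iteratedDeriv 2 V (extendZero A (Φ t ω) i - extendZero A (Φ t ω) j))
      i₀ ℱ X P

/-- The event `τ_A > τ_ρ`: `X` leaves the box `B(0, ρ)` strictly before it hits `A`. -/
def exitsBefore (X : ℝ≥0 → Ω → ℤ × ℤ) (A : Set (ℤ × ℤ)) (ρ : ℝ) : Set Ω :=
  {ω | hittingAfter X (box 0 ρ)ᶜ 0 ω < hittingAfter X A 0 ω}

end PinnedField

end

open PinnedField

namespace PinnedField

open Filter Topology

variable {Ω : Type*} {mΩ : MeasurableSpace Ω}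

/-! ### Paths in a discrete space -/

/-! Tile `ℤ²` by the blocks of side `2l+1` centred at the points of `ℤ²_l`, and mark those that meet
`A`. The blocks met by a nearest-neighbour trajectory form a path of `ℤ²_l`. If the trajectory
leaves `B(0, rl)`, one more step takes this path across the boundary of the renormalized box.
Dirtiness then forces at least `εr - 1` distinct marked blocks to have been visited
(`reachableIn_path`, `exists_visited_blocks`).

Each first visit to a marked block carries a chance at least `p = κ^(4l)`, with `κ = (1+4c²)⁻¹`, of
being killed before the block is left. The reason is a single barrier: for `z ∈ A`, the function
`κ^d(y,z)` in the block of `z`, extended by `0`, is subharmonic for the killed generator whatever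
the elliptic rates are (`killedGen_blockFun_nonneg`). Hence it is a submartingale along the walk,
under random and time-dependent rates alike, and no Markov property is needed.

To multiply these chances without stopping times, the walk is sampled on a time grid. With `Q =
(1-p)⁻¹`, the weight `Q^#v`, times `1 - h` while the path is still in the newest marked block, has
nonincreasing mean; this gives `Q^(1-m)` for visiting `m` marked blocks (`measure_isDone_le`).
Refining the grid transfers the bound to continuous time (`eventually_isDone`).

The martingale problem does not directly state that jumps go to neighbours. This is derived in
`IsKilledWalk.ae_jump_mem_nbrs` by testing with the indicator of the non-neighbours. Both parts of
the theorem are then instances of `IsKilledWalk.measure_exitsBefore_le_exp`. -/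

lemma rightGrid_gt (n : ℕ) (t : ℝ≥0) :
    t < ((⌊t * (n + 1)⌋₊ + 1 : ℕ) : ℝ≥0) / (n + 1) := by
  rw [lt_div_iff₀ (by positivity)]
  exact_mod_cast Nat.lt_floor_add_one (t * (n + 1))

lemma rightGrid_le (n : ℕ) (t : ℝ≥0) :
    ((⌊t * (n + 1)⌋₊ + 1 : ℕ) : ℝ≥0) / (n + 1) ≤ t + 1 / (n + 1) := by
  rw [div_le_iff₀ (by positivity), add_mul, one_div, inv_mul_cancel₀ (by positivity)]
  push_cast
  gcongr
  exact Nat.floor_le (by positivity)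

/-- Taking `⌊·⌋ + 1` puts the grid point strictly to the right of `t`, where right-continuity in a
discrete space makes the path eventually constant. -/
lemma tendsto_rightGrid (t : ℝ≥0) :
    Tendsto (fun n : ℕ => ((⌊t * (n + 1)⌋₊ + 1 : ℕ) : ℝ≥0) / (n + 1)) atTop (𝓝[≥] t) := by
  refine tendsto_nhdsWithin_iff.2 ⟨?_, Eventually.of_forall fun n => (rightGrid_gt n t).le⟩
  refine tendsto_of_tendsto_of_tendsto_of_le_of_le tendsto_const_nhds ?_
    (fun n => (rightGrid_gt n t).le) (fun n => rightGrid_le n t)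
  simpa using (tendsto_const_nhds (x := t)).add (tendsto_one_div_add_atTop_nhds_zero_nat (𝕜 := ℝ≥0))

/-- A right-continuous path in `ℤ²` is measurable. -/
lemma measurable_of_right_const {x : ℝ≥0 → ℤ × ℤ} (hx : ∀ t, ∀ᶠ s in 𝓝[≥] t, x s = x t) :
    Measurable x := by
  refine measurable_of_tendsto_metrizable
    (β := ℤ × ℤ)
    (f := fun (n : ℕ) (t : ℝ≥0) => x (((⌊t * (n + 1)⌋₊ + 1 : ℕ) : ℝ≥0) / (n + 1))) (fun n => ?_) ?_
  · exact (measurable_from_nat (f := fun k : ℕ => x (((k + 1 : ℕ) : ℝ≥0) / (n + 1)))).comp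
      (Nat.measurable_floor.comp (measurable_id.mul_const _))
  · refine tendsto_pi_nhds.2 fun t => ?_
    exact tendsto_const_nhds.congr' (((tendsto_rightGrid t).eventually (hx t)).mono
      fun _ h => h.symm)

/-! ### Uniformly elliptic rates -/

/-- Measurable rates with values in `[1 / c, c]`. -/
structure EllipticRates (c : ℝ) (a : ℝ≥0 → Ω → ℤ × ℤ → ℤ × ℤ → ℝ) : Prop where
  measurable : ∀ ω i j, Measurable fun t => a t ω i j
  bounds : ∀ t ω i, ∀ j ∈ nbrs i, 1 / c ≤ a t ω i j ∧ a t ω i j ≤ c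

lemma card_nbrs_le (i : ℤ × ℤ) : (nbrs i).card ≤ 4 := Finset.card_le_four

lemma abs_killedGen_le {A : Set (ℤ × ℤ)} {a : ℤ × ℤ → ℤ × ℤ → ℝ} {c C : ℝ} (hc : 1 ≤ c)
    (ha : ∀ i, ∀ j ∈ nbrs i, 1 / c ≤ a i j ∧ a i j ≤ c) {f : ℤ × ℤ → ℝ} (hf : ∀ i, |f i| ≤ C)
    (i : ℤ × ℤ) : |killedGen A a f i| ≤ 8 * c * C := by
  have hC : 0 ≤ C := (abs_nonneg _).trans (hf i)
  have hc0 : 0 < 1 / c := by positivity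
  unfold killedGen
  split_ifs
  · simp only [abs_zero]; positivity
  refine (Finset.abs_sum_le_sum_abs _ _).trans ?_
  refine (Finset.sum_le_card_nsmul _ _ (c * (2 * C)) fun j hj => ?_).trans ?_
  · rw [abs_mul]
    have h1 : |a i j| ≤ c := by
      rw [abs_of_pos (hc0.trans_le (ha i j hj).1)]; exact (ha i j hj).2
    have h2 : |f j - f i| ≤ 2 * C := by
      have := abs_sub (f j) (f i)
      linarith [hf i, hf j]
    exact mul_le_mul h1 h2 (abs_nonneg _) (by linarith)
  · rw [nsmul_eq_mul]
    have : ((nbrs i).card : ℝ) ≤ 4 := by exact_mod_cast card_nbrs_le i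
    calc ((nbrs i).card : ℝ) * (c * (2 * C)) ≤ 4 * (c * (2 * C)) := by gcongr
      _ = 8 * c * C := by ring

/-- The compensator of `f (X t)`. -/
noncomputable def compensator (A : Set (ℤ × ℤ)) (a : ℝ≥0 → Ω → ℤ × ℤ → ℤ × ℤ → ℝ)
    (X : ℝ≥0 → Ω → ℤ × ℤ) (f : ℤ × ℤ → ℝ) (t : ℝ≥0) (ω : Ω) : ℝ :=
  ∫ s in (0 : ℝ)..(t : ℝ), killedGen A (a s.toNNReal ω) f (X s.toNNReal ω)

/-! ### Martingale identities for the walk -/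

section

variable {A : Set (ℤ × ℤ)} {a : ℝ≥0 → Ω → ℤ × ℤ → ℤ × ℤ → ℝ} {X : ℝ≥0 → Ω → ℤ × ℤ}
  {c C : ℝ} {f : ℤ × ℤ → ℝ}

lemma measurable_killedGen_path (ha : EllipticRates c a) (f : ℤ × ℤ → ℝ) {ω : Ω}
    (hX : ∀ t, ∀ᶠ s in 𝓝[≥] t, X s ω = X t ω) :
    Measurable fun s : ℝ => killedGen A (a s.toNNReal ω) f (X s.toNNReal ω) := by
  have hx : Measurable fun t => X t ω := measurable_of_right_const hX
  have h : Measurable fun p : ℝ≥0 × (ℤ × ℤ) => killedGen A (a p.1 ω) f p.2 := by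
    refine measurable_from_prod_countable_left fun i => ?_
    unfold killedGen
    by_cases hi : i ∈ A
    · simp [hi]
    · simp only [hi, if_false]
      exact Finset.measurable_sum _ fun j _ => (ha.measurable ω i j).mul_const _
  exact (h.comp (measurable_id.prodMk hx)).comp measurable_real_toNNReal

lemma intervalIntegrable_killedGen (hc : 1 ≤ c) (ha : EllipticRates c a)
    (hf : ∀ i, |f i| ≤ C) {ω : Ω} (hX : ∀ t, ∀ᶠ s in 𝓝[≥] t, X s ω = X t ω) (u v : ℝ) :
    IntervalIntegrable (fun s : ℝ => killedGen A (a s.toNNReal ω) f (X s.toNNReal ω))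
      volume u v := by
  refine (intervalIntegrable_const (c := 8 * c * C)).mono_fun
    (measurable_killedGen_path ha f hX).aestronglyMeasurable (Eventually.of_forall fun s => ?_)
  rw [Real.norm_eq_abs]
  exact (abs_killedGen_le hc (fun i j hj => ha.bounds _ _ i j hj) hf _).trans (le_abs_self _)

lemma compensator_sub (hc : 1 ≤ c) (ha : EllipticRates c a)
    (hf : ∀ i, |f i| ≤ C) {ω : Ω} (hX : ∀ t, ∀ᶠ s in 𝓝[≥] t, X s ω = X t ω) (u v : ℝ≥0) :
    compensator A a X f v ω - compensator A a X f u ω =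
      ∫ s in (u : ℝ)..(v : ℝ), killedGen A (a s.toNNReal ω) f (X s.toNNReal ω) :=
  intervalIntegral.integral_interval_sub_left
    (intervalIntegrable_killedGen hc ha hf hX _ _) (intervalIntegrable_killedGen hc ha hf hX _ _)

variable {i₀ : ℤ × ℤ} {ℱ : Filtration ℝ≥0 mΩ} {P : Measure Ω}

lemma IsKilledWalk.measurable (hX : IsKilledWalk A a i₀ ℱ X P) (t : ℝ≥0) : Measurable (X t) :=
  (hX.adapted t).mono (ℱ.le t) le_rfl

variable [IsProbabilityMeasure P]

lemma IsKilledWalk.integrable_comp (hX : IsKilledWalk A a i₀ ℱ X P) (hf : ∀ i, |f i| ≤ C)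
    (t : ℝ≥0) : Integrable (fun ω => f (X t ω)) P :=
  Integrable.of_bound ((measurable_of_countable f).comp (hX.measurable t)).aestronglyMeasurable C
    (Eventually.of_forall fun _ => hf _)

lemma IsKilledWalk.integrable_compensator (hX : IsKilledWalk A a i₀ ℱ X P)
    (hf : ∀ i, |f i| ≤ C) (t : ℝ≥0) : Integrable (compensator A a X f t) P := by
  have h := (hX.integrable_comp hf t).sub ((hX.martingale f ⟨C, hf⟩).integrable t)
  refine h.congr (Eventually.of_forall fun ω => ?_)
  simp [compensator]

/-- The increment form of the martingale property, with the function and its compensator separated.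
It serves both the barrier and the exclusion of long jumps. -/
lemma IsKilledWalk.setIntegral_sub (hX : IsKilledWalk A a i₀ ℱ X P)
    (hf : ∀ i, |f i| ≤ C) {s t : ℝ≥0} (hst : s ≤ t) {F : Set Ω} (hF : MeasurableSet[ℱ s] F) :
    ∫ ω in F, (f (X t ω) - f (X s ω)) ∂P =
      ∫ ω in F, (compensator A a X f t ω - compensator A a X f s ω) ∂P := by
  have h := (hX.martingale f ⟨C, hf⟩).setIntegral_eq hst hF
  change ∫ ω in F, (f (X s ω) - compensator A a X f s ω) ∂P =
    ∫ ω in F, (f (X t ω) - compensator A a X f t ω) ∂P at h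
  have i1 := fun t => (hX.integrable_comp (P := P) hf t).integrableOn (s := F)
  have i2 := fun t => (hX.integrable_compensator (P := P) hf t).integrableOn (s := F)
  rw [integral_sub (i1 _) (i2 _), integral_sub (i1 _) (i2 _)] at h
  rw [integral_sub (i1 _) (i1 _), integral_sub (i2 _) (i2 _)]
  linarith

/-- A bounded function on which all generators are nonnegative is a submartingale along the walk. -/
lemma IsKilledWalk.setIntegral_mono (hX : IsKilledWalk A a i₀ ℱ X P) (hc : 1 ≤ c)
    (ha : EllipticRates c a) (hf : ∀ i, |f i| ≤ C)
    (hL : ∀ t ω i, 0 ≤ killedGen A (a t ω) f i) {s t : ℝ≥0} (hst : s ≤ t) {F : Set Ω}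
    (hF : MeasurableSet[ℱ s] F) :
    ∫ ω in F, f (X s ω) ∂P ≤ ∫ ω in F, f (X t ω) ∂P := by
  have h := hX.setIntegral_sub hf hst hF
  rw [integral_sub (hX.integrable_comp hf _).integrableOn
    (hX.integrable_comp hf _).integrableOn] at h
  have : 0 ≤ ∫ ω in F, (compensator A a X f t ω - compensator A a X f s ω) ∂P := by
    refine integral_nonneg fun ω => ?_
    simp only [Pi.zero_apply]
    rw [compensator_sub hc ha hf (hX.right_cont ω)]
    exact intervalIntegral.integral_nonneg (by exact_mod_cast hst) fun s _ => hL _ _ _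
  linarith

end

/-! ### Blocks -/

/-- The centre of the interval of length `2l+1` that contains `n`. -/
def blockCoord (l : ℕ) (n : ℤ) : ℤ := (2 * (l : ℤ) + 1) * ((n + l) / (2 * (l : ℤ) + 1))

/-- The centre of the block that contains `y`. -/
def blockCenter (l : ℕ) (y : ℤ × ℤ) : ℤ × ℤ := (blockCoord l y.1, blockCoord l y.2)

lemma blockCoord_spec (l : ℕ) (n : ℤ) : |blockCoord l n - n| ≤ l := by
  have h1 := Int.emod_add_mul_ediv (n + l) (2 * (l : ℤ) + 1)
  have h2 := Int.emod_nonneg (n + l) (show 2 * (l : ℤ) + 1 ≠ 0 by omega)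
  have h3 := Int.emod_lt_of_pos (n + l) (show 0 < 2 * (l : ℤ) + 1 by omega)
  unfold blockCoord
  rw [abs_le]
  constructor <;> linarith

lemma blockCoord_eq_of_dvd {l : ℕ} {m n : ℤ} (hm : 2 * (l : ℤ) + 1 ∣ m) (h : |m - n| ≤ l) :
    blockCoord l n = m := by
  obtain ⟨k, rfl⟩ := hm
  rw [abs_le] at h
  unfold blockCoord
  congr 1
  have hp : 0 < 2 * (l : ℤ) + 1 := by omega
  apply le_antisymm
  · apply Int.lt_add_one_iff.1
    rw [Int.ediv_lt_iff_lt_mul hp]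
    linarith
  · rw [Int.le_ediv_iff_mul_le hp]
    linarith

lemma blockCoord_mono (l : ℕ) : Monotone (blockCoord l) := fun m n h => by
  unfold blockCoord
  have : (m + l) / (2 * (l : ℤ) + 1) ≤ (n + l) / (2 * (l : ℤ) + 1) :=
    Int.ediv_le_ediv (by omega) (by omega)
  gcongr

lemma blockCoord_add_one (l : ℕ) (n : ℤ) :
    blockCoord l (n + 1) = blockCoord l n ∨
      blockCoord l (n + 1) = blockCoord l n + (2 * (l : ℤ) + 1) := by
  have h1 : (n + l) / (2 * (l : ℤ) + 1) ≤ (n + 1 + l) / (2 * (l : ℤ) + 1) :=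
    Int.ediv_le_ediv (by omega) (by omega)
  have h2 : (n + 1 + l) / (2 * (l : ℤ) + 1) ≤ (n + l) / (2 * (l : ℤ) + 1) + 1 := by
    rw [← Int.add_mul_ediv_right _ 1 (by omega)]
    exact Int.ediv_le_ediv (by omega) (by omega)
  unfold blockCoord
  rcases h1.eq_or_lt with h | h
  · left; rw [h]
  · right
    rw [show (n + 1 + l) / (2 * (l : ℤ) + 1) = (n + l) / (2 * (l : ℤ) + 1) + 1 by omega]
    ring

lemma blockCenter_mem_renLattice (l : ℕ) (y : ℤ × ℤ) : blockCenter l y ∈ renLattice l :=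
  ⟨dvd_mul_right _ _, dvd_mul_right _ _⟩

lemma blockCenter_zero (l : ℕ) : blockCenter l 0 = 0 := by
  have : blockCoord l 0 = 0 := blockCoord_eq_of_dvd (dvd_zero _) (by simp)
  ext <;> simp [blockCenter, this]

lemma mem_box_iff {x y : ℤ × ℤ} {ρ : ℝ} :
    y ∈ box x ρ ↔ ((|x.1 - y.1| : ℤ) : ℝ) ≤ ρ ∧ ((|x.2 - y.2| : ℤ) : ℝ) ≤ ρ := by
  simp [box, Prod.norm_def, Int.norm_eq_abs]

lemma blockCenter_eq_of_mem_box {l : ℕ} {x y : ℤ × ℤ} (hx : x ∈ renLattice l)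
    (hy : y ∈ box x l) : blockCenter l y = x := by
  rw [mem_box_iff] at hy
  exact Prod.ext (blockCoord_eq_of_dvd hx.1 (by exact_mod_cast hy.1))
    (blockCoord_eq_of_dvd hx.2 (by exact_mod_cast hy.2))

lemma mem_nbrs {i j : ℤ × ℤ} : j ∈ nbrs i ↔ j = (i.1 + 1, i.2) ∨ j = (i.1 - 1, i.2) ∨
    j = (i.1, i.2 + 1) ∨ j = (i.1, i.2 - 1) := by
  simp [nbrs]

/-- A unit step changes one coordinate only, and that block coordinate moves by `0` or `2l+1`. This
projects trajectories to paths of `ℤ²_l`. -/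
lemma renGraph_adj_blockCenter {l : ℕ} {i j : ℤ × ℤ} (h : j ∈ nbrs i) :
    blockCenter l i = blockCenter l j ∨ (renGraph l).Adj (blockCenter l i) (blockCenter l j) := by
  have key : ∀ n m : ℤ, (m = n + 1 ∨ m = n - 1) → blockCoord l n = blockCoord l m ∨
      |blockCoord l n - blockCoord l m| = 2 * (l : ℤ) + 1 := by
    have hl : 0 ≤ 2 * (l : ℤ) + 1 := by omega
    rintro n m (rfl | rfl)
    · rcases blockCoord_add_one l n with h | h
      · exact .inl h.symm
      · right; rw [h, sub_add_cancel_left, abs_neg, abs_of_nonneg hl]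
    · rcases blockCoord_add_one l (n - 1) with h | h <;> rw [sub_add_cancel] at h
      · exact .inl h
      · right; rw [h, add_sub_cancel_left, abs_of_nonneg hl]
  have fst : ∀ n m k : ℤ, (m = n + 1 ∨ m = n - 1) → blockCenter l (n, k) = blockCenter l (m, k) ∨
      (renGraph l).Adj (blockCenter l (n, k)) (blockCenter l (m, k)) := fun n m k h => by
    refine (key n m h).imp (fun h => by simp [blockCenter, h]) fun h =>
      ⟨blockCenter_mem_renLattice _ _, blockCenter_mem_renLattice _ _, ?_⟩
    simpa [blockCenter] using h
  have snd : ∀ n m k : ℤ, (m = n + 1 ∨ m = n - 1) → blockCenter l (k, n) = blockCenter l (k, m) ∨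
      (renGraph l).Adj (blockCenter l (k, n)) (blockCenter l (k, m)) := fun n m k h => by
    refine (key n m h).imp (fun h => by simp [blockCenter, h]) fun h =>
      ⟨blockCenter_mem_renLattice _ _, blockCenter_mem_renLattice _ _, ?_⟩
    simpa [blockCenter] using h
  rcases mem_nbrs.1 h with rfl | rfl | rfl | rfl
  · exact fst _ _ _ (.inl rfl)
  · exact fst _ _ _ (.inr rfl)
  · exact snd _ _ _ (.inl rfl)
  · exact snd _ _ _ (.inr rfl)

/-! ### A subharmonic function in a block -/

/-- The `ℓ¹`-distance on `ℤ²`. -/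
def dist₁ (y z : ℤ × ℤ) : ℕ := (y.1 - z.1).natAbs + (y.2 - z.2).natAbs

/-- Each coordinate varies by at most `2l` within a block; this is the source of the exponent `4l`
in `p`. -/
lemma dist₁_le {l : ℕ} {y z : ℤ × ℤ} (h : blockCenter l y = blockCenter l z) :
    dist₁ y z ≤ 4 * l := by
  have h1 := congrArg Prod.fst h
  have h2 := congrArg Prod.snd h
  simp only [blockCenter] at h1 h2
  have a1 := abs_le.1 (blockCoord_spec l y.1)
  have a2 := abs_le.1 (blockCoord_spec l y.2)
  have a3 := abs_le.1 (blockCoord_spec l z.1)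
  have a4 := abs_le.1 (blockCoord_spec l z.2)
  unfold dist₁
  omega

/-- Inside a block one can step towards any site of the block. -/
lemma exists_nbr_closer {l : ℕ} {i z : ℤ × ℤ} (h : blockCenter l i = blockCenter l z)
    (hne : i ≠ z) : ∃ j ∈ nbrs i, blockCenter l j = blockCenter l z ∧
      dist₁ i z = dist₁ j z + 1 := by
  obtain ⟨i1, i2⟩ := i
  obtain ⟨z1, z2⟩ := z
  simp only [blockCenter, Prod.mk.injEq] at h
  have up : ∀ m n : ℤ, blockCoord l m = blockCoord l n → m < n →
      blockCoord l (m + 1) = blockCoord l n := fun m n h hlt =>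
    le_antisymm (blockCoord_mono l (by omega)) (h ▸ blockCoord_mono l (by omega))
  have down : ∀ m n : ℤ, blockCoord l m = blockCoord l n → n < m →
      blockCoord l (m - 1) = blockCoord l n := fun m n h hlt =>
    le_antisymm (h ▸ blockCoord_mono l (by omega)) (blockCoord_mono l (by omega))
  rcases lt_trichotomy i1 z1 with h1 | h1 | h1
  · refine ⟨(i1 + 1, i2), by simp [nbrs], ?_, by simp only [dist₁]; omega⟩
    simp [blockCenter, up _ _ h.1 h1, h.2]
  · rcases lt_trichotomy i2 z2 with h2 | h2 | h2
    · refine ⟨(i1, i2 + 1), by simp [nbrs], ?_, by simp only [dist₁]; omega⟩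
      simp [blockCenter, up _ _ h.2 h2, h.1]
    · exact absurd (Prod.ext h1 h2) hne
    · refine ⟨(i1, i2 - 1), by simp [nbrs], ?_, by simp only [dist₁]; omega⟩
      simp [blockCenter, down _ _ h.2 h2, h.1]
  · refine ⟨(i1 - 1, i2), by simp [nbrs], ?_, by simp only [dist₁]; omega⟩
    simp [blockCenter, down _ _ h.1 h1, h.2]

/-- The function `κ ^ d(y, z)` in the block of `z`, extended by zero. -/
noncomputable def blockFun (l : ℕ) (κ : ℝ) (z y : ℤ × ℤ) : ℝ :=
  if blockCenter l y = blockCenter l z then κ ^ dist₁ y z else 0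

lemma blockFun_nonneg {l : ℕ} {κ : ℝ} (hκ : 0 ≤ κ) (z y : ℤ × ℤ) : 0 ≤ blockFun l κ z y := by
  unfold blockFun
  split_ifs <;> positivity

lemma blockFun_le_one {l : ℕ} {κ : ℝ} (hκ : 0 ≤ κ) (hκ1 : κ ≤ 1) (z y : ℤ × ℤ) :
    blockFun l κ z y ≤ 1 := by
  unfold blockFun
  split_ifs
  · exact pow_le_one₀ hκ hκ1
  · exact zero_le_one

lemma le_blockFun {l : ℕ} {κ : ℝ} (hκ : 0 ≤ κ) (hκ1 : κ ≤ 1) {z y : ℤ × ℤ}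
    (h : blockCenter l y = blockCenter l z) : κ ^ (4 * l) ≤ blockFun l κ z y := by
  rw [blockFun, if_pos h]
  exact pow_le_pow_of_le_one hκ hκ1 (dist₁_le h)

/-- For `z ∈ A` the function `blockFun` is subharmonic for all elliptic rates. -/
lemma killedGen_blockFun_nonneg {A : Set (ℤ × ℤ)} {a : ℤ × ℤ → ℤ × ℤ → ℝ} {c : ℝ} (hc : 1 ≤ c)
    (ha : ∀ i, ∀ j ∈ nbrs i, 1 / c ≤ a i j ∧ a i j ≤ c) {l : ℕ} {z : ℤ × ℤ} (hz : z ∈ A)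
    (i : ℤ × ℤ) : 0 ≤ killedGen A a (blockFun l (1 + 4 * c ^ 2)⁻¹ z) i := by
  -- At a site of value `u`, a step towards `z` contributes at least `(1/c)(1/κ - 1)u = 4cu`, while
  -- each of the other neighbours, at most four, contributes at least `-cu`.
  set κ : ℝ := (1 + 4 * c ^ 2)⁻¹ with hκ
  have hc0 : 0 < c := by linarith
  have hκ0 : 0 ≤ κ := by positivity
  have ha0 : ∀ j ∈ nbrs i, 0 ≤ a i j := fun j hj => (by positivity : 0 ≤ 1 / c).trans (ha i j hj).1
  unfold killedGen
  split_ifs with hi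
  · exact le_rfl
  by_cases hb : blockCenter l i = blockCenter l z
  -- Killing at `z` removes the maximum of the function, the site where no neighbour is closer.
  · obtain ⟨j₀, hj₀, hjb, hd⟩ := exists_nbr_closer hb (fun h => hi (h ▸ hz))
    rw [← Finset.add_sum_erase _ _ hj₀]
    set u := blockFun l κ z i with hu
    have hu0 : 0 ≤ u := blockFun_nonneg hκ0 _ _
    have h0 : blockFun l κ z j₀ = (1 + 4 * c ^ 2) * u := by
      rw [hu, blockFun, blockFun, if_pos hjb, if_pos hb, hd, pow_succ' κ, ← mul_assoc,
        hκ, mul_inv_cancel₀ (by positivity), one_mul]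
    have h1 : 4 * c * u ≤ a i j₀ * (blockFun l κ z j₀ - u) := by
      rw [h0]
      calc 4 * c * u = 1 / c * ((1 + 4 * c ^ 2) * u - u) := by field_simp; ring
        _ ≤ _ := mul_le_mul_of_nonneg_right (ha i j₀ hj₀).1 (by nlinarith [sq_nonneg c])
    have h2 : ((nbrs i).erase j₀).card • (-(c * u)) ≤
        ∑ j ∈ (nbrs i).erase j₀, a i j * (blockFun l κ z j - u) := by
      refine Finset.card_nsmul_le_sum _ _ _ fun j hj => ?_
      have hj' := Finset.mem_of_mem_erase hj
      have h3 := blockFun_nonneg (l := l) hκ0 z j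
      have h4 : a i j * u ≤ c * u := mul_le_mul_of_nonneg_right (ha i j hj').2 hu0
      have h5 := mul_nonneg (ha0 j hj') h3
      linarith
    have h3 : (((nbrs i).erase j₀).card : ℝ) ≤ 4 := by
      exact_mod_cast (Finset.card_erase_le).trans (card_nbrs_le i)
    rw [nsmul_eq_mul] at h2
    nlinarith [mul_nonneg hc0.le hu0]
  · refine Finset.sum_nonneg fun j hj => mul_nonneg (ha0 j hj) ?_
    rw [show blockFun l κ z i = 0 from if_neg hb, sub_zero]
    exact blockFun_nonneg hκ0 _ _

/-! ### Counting the visits to marked blocks along a discrete path -/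

/-- The state of the exploration of the marked blocks: `none` if the path has been killed,
otherwise the set of marked blocks visited so far, and the current block if the path has not left
it since its first visit there. -/
abbrev VisitState : Type := Option (Finset (ℤ × ℤ) × Option (ℤ × ℤ))

open Classical in
/-- The exploration goes on until `m` marked blocks have been visited or the path is killed. -/
noncomputable def visitStep (A D : Set (ℤ × ℤ)) (b : ℤ × ℤ → ℤ × ℤ) (m : ℕ) :
    VisitState → ℤ × ℤ → VisitState
  | none, _ => none
  | some (v, o), y =>
    if m ≤ v.card then some (v, o)
    else if y ∈ A then none
    else if o = some (b y) then some (v, o)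
    else if b y ∈ D ∧ b y ∉ v then some (insert (b y) v, some (b y))
    else some (v, none)

/-- The state of the exploration along the path `y`. -/
noncomputable def visitState (A D : Set (ℤ × ℤ)) (b : ℤ × ℤ → ℤ × ℤ) (m : ℕ) (y : ℕ → ℤ × ℤ) :
    ℕ → VisitState
  | 0 => visitStep A D b m (some (∅, none)) (y 0)
  | k + 1 => visitStep A D b m (visitState A D b m y k) (y (k + 1))

/-- `m` marked blocks have been visited. -/
def VisitState.IsDone (m : ℕ) (σ : VisitState) : Prop := ∃ v o, σ = some (v, o) ∧ m ≤ v.card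

/-! ### The exploration and its weight along a fixed path -/

section

variable {A D : Set (ℤ × ℤ)} {b : ℤ × ℤ → ℤ × ℤ} {m : ℕ}

lemma visitStep_of_isDone {σ : VisitState} (h : σ.IsDone m) (y : ℤ × ℤ) :
    visitStep A D b m σ y = σ := by
  obtain ⟨v, o, rfl, h⟩ := h
  simp [visitStep, h]

lemma visitState_isDone_mono {y : ℕ → ℤ × ℤ} {k k' : ℕ} (hk : k ≤ k')
    (h : (visitState A D b m y k).IsDone m) : (visitState A D b m y k').IsDone m := by
  induction hk with
  | refl => exact h
  | step _ ih => rw [visitState, visitStep_of_isDone ih]; exact ih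

/-- The exploration is done, or it knows the set `S` of marked blocks. -/
def VisitState.Knows (m : ℕ) (S : Set (ℤ × ℤ)) (σ : VisitState) : Prop :=
  σ.IsDone m ∨ ∃ v o, σ = some (v, o) ∧ S ⊆ v ∧ ∀ B, o = some B → B ∈ v

/-- The invariant records that the current block is already in `v`, because the exploration inserts
nothing while the path stays there. -/
lemma VisitState.Knows.step {σ : VisitState} {S : Set (ℤ × ℤ)} (h : σ.Knows m S)
    {y : ℤ × ℤ} (hy : y ∉ A) : (visitStep A D b m σ y).Knows m (S ∪ {B | B ∈ D ∧ B = b y}) := by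
  rcases h with h | ⟨v, o, rfl, hS, ho⟩
  · rw [visitStep_of_isDone h]; exact .inl h
  by_cases h1 : m ≤ v.card
  · have : VisitState.IsDone m (some (v, o)) := ⟨v, o, rfl, h1⟩
    rw [visitStep_of_isDone this]; exact .inl this
  simp only [visitStep, h1, hy, if_false]
  split_ifs with h2 h3
  · refine .inr ⟨v, o, rfl, Set.union_subset hS ?_, ho⟩
    rintro B ⟨-, rfl⟩
    exact ho _ h2
  · refine .inr ⟨_, _, rfl, Set.union_subset (fun B hB => ?_) ?_, ?_⟩
    · exact Finset.mem_coe.2 (Finset.mem_insert_of_mem (hS hB))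
    · rintro B ⟨-, rfl⟩
      exact Finset.mem_coe.2 (Finset.mem_insert_self _ _)
    · rintro B ⟨⟩
      exact Finset.mem_insert_self _ _
  · refine .inr ⟨_, _, rfl, Set.union_subset hS ?_, by simp⟩
    rintro B ⟨hB, rfl⟩
    exact not_not.1 fun h => h3 ⟨hB, h⟩

lemma visitState_knows {y : ℕ → ℤ × ℤ} {k : ℕ} (hy : ∀ j ≤ k, y j ∉ A) :
    (visitState A D b m y k).Knows m {B | B ∈ D ∧ ∃ j ≤ k, B = b (y j)} := by
  induction k with
  | zero =>
    have h : VisitState.Knows m ∅ (some (∅, none)) := .inr ⟨∅, none, rfl, by simp, by simp⟩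
    simpa [visitState] using h.step (D := D) (b := b) (hy 0 le_rfl)
  | succ k ih =>
    have h := (ih fun j hj => hy j (by omega)).step (D := D) (b := b) (hy (k + 1) le_rfl)
    have hset : {B | B ∈ D ∧ ∃ j ≤ k, B = b (y j)} ∪ {B | B ∈ D ∧ B = b (y (k + 1))} =
        {B | B ∈ D ∧ ∃ j ≤ k + 1, B = b (y j)} := by
      ext B
      simp only [Set.mem_union, Set.mem_ofPred_eq, Nat.le_succ_iff, or_and_right, exists_or,
        exists_eq_left, ← and_or_left]
    rw [hset] at h
    exact h

/-- A path that visits `m` marked blocks before it is killed completes the exploration. -/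
lemma visitState_isDone {y : ℕ → ℤ × ℤ} {k k' : ℕ} (hk : k ≤ k') (hy : ∀ j ≤ k, y j ∉ A)
    {F : Finset (ℤ × ℤ)} (hFD : ∀ B ∈ F, B ∈ D) (hF : ∀ B ∈ F, ∃ j ≤ k, B = b (y j))
    (hm : m ≤ F.card) : (visitState A D b m y k').IsDone m := by
  refine visitState_isDone_mono hk ?_
  rcases visitState_knows (D := D) (b := b) (m := m) hy with h | ⟨v, o, h, hv, -⟩
  · exact h
  · exact ⟨v, o, h, hm.trans (Finset.card_le_card fun B hB => hv ⟨hFD B hB, hF B hB⟩)⟩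

/-- The weight of a state: `Q ^ #v` in general, and `Q ^ #v * (1 - h B y)` in a block `B` that the
path has not left since its first visit. -/
noncomputable def visitWeight (Q : ℝ) (h : ℤ × ℤ → ℤ × ℤ → ℝ) (m : ℕ) :
    VisitState → ℤ × ℤ → ℝ
  | none, _ => 0
  | some (v, o), y =>
    if m ≤ v.card then Q ^ (m - 1)
    else match o with
      | none => Q ^ v.card
      | some B => Q ^ v.card * (1 - h B y)

variable {Q : ℝ} {h : ℤ × ℤ → ℤ × ℤ → ℝ}

lemma visitWeight_of_isDone {σ : VisitState} (hσ : σ.IsDone m) (y : ℤ × ℤ) :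
    visitWeight Q h m σ y = Q ^ (m - 1) := by
  obtain ⟨v, o, rfl, hv⟩ := hσ
  simp [visitWeight, hv]

lemma visitWeight_nonneg (hQ : 1 ≤ Q) (h1 : ∀ B y, h B y ≤ 1) (σ : VisitState) (y : ℤ × ℤ) :
    0 ≤ visitWeight Q h m σ y := by
  have hQ0 : 0 ≤ Q := by linarith
  rcases σ with _ | ⟨v, _ | B⟩ <;> simp only [visitWeight]
  · exact le_rfl
  · split_ifs <;> positivity
  · split_ifs
    · positivity
    · exact mul_nonneg (by positivity) (by linarith [h1 B y])

/-- The state is updated with the site held fixed. Leaving a block costs nothing since `h` vanishes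
outside it, entering a new marked block multiplies the weight by `Q(1 - h) ≤ 1`, and killing sets it
to zero. -/
lemma visitWeight_step_le (hQ : 1 ≤ Q) (h1 : ∀ B y, h B y ≤ 1)
    (hoff : ∀ B y, b y ≠ B → h B y = 0) (hon : ∀ y, b y ∈ D → Q * (1 - h (b y) y) ≤ 1)
    (σ : VisitState) (y : ℤ × ℤ) :
    visitWeight Q h m (visitStep A D b m σ y) y ≤ visitWeight Q h m σ y := by
  have hnn := visitWeight_nonneg (m := m) hQ h1 σ y
  have hQ0 : 0 ≤ Q := by linarith
  rcases σ with _ | ⟨v, o⟩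
  · simp [visitStep]
  by_cases hd : m ≤ v.card
  · rw [visitStep_of_isDone ⟨v, o, rfl, hd⟩]
  by_cases hA : y ∈ A
  · simpa [visitStep, hd, hA, visitWeight] using hnn
  by_cases ho : o = some (b y)
  · simp [visitStep, hd, hA, ho]
  have hσ : visitWeight Q h m (some (v, o)) y = Q ^ v.card := by
    rcases o with _ | B
    · simp [visitWeight, hd]
    · simp [visitWeight, hd, hoff B y fun h => ho (by rw [h])]
  rw [hσ]
  by_cases hn : b y ∈ D ∧ b y ∉ v
  · simp only [visitStep, hd, hA, ho, hn, if_false, not_false_eq_true, and_self, if_true,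
      visitWeight, Finset.card_insert_of_notMem]
    split_ifs with h2
    -- The `m`-th block completes the exploration on entry, so it earns no factor `Q`; hence the
    -- exponent `m - 1`.
    · rw [show m - 1 = v.card by omega]
    · calc Q ^ (v.card + 1) * (1 - h (b y) y) = Q ^ v.card * (Q * (1 - h (b y) y)) := by ring
        _ ≤ Q ^ v.card * 1 := by gcongr; exact hon y hn.1
        _ = Q ^ v.card := mul_one _
  · simp [visitStep, hd, hA, ho, hn, visitWeight]

end

/-! ### The supermartingale estimate in discrete time -/

section

variable {P : Measure Ω} [IsProbabilityMeasure P]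
  {A D : Set (ℤ × ℤ)} {b : ℤ × ℤ → ℤ × ℤ} {m : ℕ} {Q : ℝ} {h : ℤ × ℤ → ℤ × ℤ → ℝ}
  {𝒢 : ℕ → MeasurableSpace Ω} {Y : ℕ → Ω → ℤ × ℤ}

lemma measurableSet_visitState (hmono : Monotone 𝒢) (hY : ∀ k, Measurable[𝒢 k] (Y k)) (k : ℕ)
    (σ : VisitState) :
    MeasurableSet[𝒢 k] {ω | visitState A D b m (fun j => Y j ω) k = σ} := by
  let _ : MeasurableSpace VisitState := ⊤
  have key : Measurable[𝒢 k] fun ω => visitState A D b m (fun j => Y j ω) k := by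
    induction k with
    | zero => exact (measurable_of_countable (visitStep A D b m (some (∅, none)))).comp (hY 0)
    | succ k ih =>
      exact (measurable_of_countable (Function.uncurry (visitStep A D b m))).comp
        ((ih.mono (hmono k.le_succ) le_rfl).prodMk (hY (k + 1)))
  exact key (MeasurableSet.of_discrete (s := {σ}))

/-- The counterpart of `visitWeight_step_le`: the site moves with the state held fixed. The weight
is then constant or affine in `h` with nonpositive slope, and the mean of `h` does not decrease. -/
lemma setLIntegral_visitWeight_le (hQ : 1 ≤ Q) (h0 : ∀ B y, 0 ≤ h B y) (h1 : ∀ B y, h B y ≤ 1)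
    {Y Y' : Ω → ℤ × ℤ} (hY : Measurable Y) (hY' : Measurable Y') {F : Set Ω}
    (hsub : ∀ B, ∫ ω in F, h B (Y ω) ∂P ≤ ∫ ω in F, h B (Y' ω) ∂P) (σ : VisitState) :
    ∫⁻ ω in F, ENNReal.ofReal (visitWeight Q h m σ (Y' ω)) ∂P ≤
      ∫⁻ ω in F, ENNReal.ofReal (visitWeight Q h m σ (Y ω)) ∂P := by
  rcases σ with _ | ⟨v, _ | B⟩
  · simp [visitWeight]
  · simp [visitWeight]
  by_cases hd : m ≤ v.card
  · simp [visitWeight, hd]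
  have hint : ∀ {Z : Ω → ℤ × ℤ}, Measurable Z → Integrable (fun ω => h B (Z ω)) (P.restrict F) :=
    fun hZ => Integrable.of_bound ((measurable_of_countable _).comp hZ).aestronglyMeasurable 1
      (Eventually.of_forall fun ω => by
        rw [Real.norm_eq_abs, abs_of_nonneg (h0 _ _)]; exact h1 _ _)
  have hQ0 : 0 ≤ Q ^ v.card := by positivity
  have hcalc : ∀ {Z : Ω → ℤ × ℤ}, Measurable Z →
      ∫⁻ ω in F, ENNReal.ofReal (visitWeight Q h m (some (v, some B)) (Z ω)) ∂P =
        ENNReal.ofReal (Q ^ v.card * ((P.restrict F).real Set.univ - ∫ ω in F, h B (Z ω) ∂P)) := by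
    intro Z hZ
    rw [← ofReal_integral_eq_lintegral_ofReal]
    · simp only [visitWeight, hd, if_false]
      rw [integral_const_mul, integral_sub (integrable_const _) (hint hZ)]
      simp
    · simp only [visitWeight, hd, if_false]
      exact ((integrable_const _).sub (hint hZ)).const_mul _
    · exact Eventually.of_forall fun ω => visitWeight_nonneg hQ h1 _ _
  rw [hcalc hY, hcalc hY']
  exact ENNReal.ofReal_le_ofReal (mul_le_mul_of_nonneg_left (sub_le_sub_left (hsub B) _) hQ0)

/-- The probability to visit `m` marked blocks is at most `Q ^ (1 - m)`. -/
lemma measure_isDone_le (hQ : 1 ≤ Q) (h0 : ∀ B y, 0 ≤ h B y) (h1 : ∀ B y, h B y ≤ 1)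
    (hoff : ∀ B y, b y ≠ B → h B y = 0) (hon : ∀ y, b y ∈ D → Q * (1 - h (b y) y) ≤ 1)
    (hm : 1 ≤ m) (hle : ∀ k, 𝒢 k ≤ mΩ)
    (hmono : Monotone 𝒢) (hY : ∀ k, Measurable[𝒢 k] (Y k))
    (hsub : ∀ k B F, MeasurableSet[𝒢 k] F →
      ∫ ω in F, h B (Y k ω) ∂P ≤ ∫ ω in F, h B (Y (k + 1) ω) ∂P) (k : ℕ) :
    P {ω | (visitState A D b m (fun j => Y j ω) k).IsDone m} ≤
      ENNReal.ofReal ((Q⁻¹) ^ (m - 1)) := by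
  set s : ℕ → Ω → VisitState := fun k ω => visitState A D b m (fun j => Y j ω) k with hs
  have hYm : ∀ k, Measurable (Y k) := fun k => (hY k).mono (hle k) le_rfl
  have hsm : ∀ k σ, MeasurableSet[𝒢 k] {ω | s k ω = σ} := measurableSet_visitState hmono hY
  -- There are countably many states, and each is attained on an event of `𝒢 k`, so the
  -- submartingale inequality for `h` applies state by state.
  have hsplit : ∀ (k : ℕ) (g : Ω → ℝ≥0∞),
      ∫⁻ ω, g ω ∂P = ∑' σ, ∫⁻ ω in {ω | s k ω = σ}, g ω ∂P := by
    intro k g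
    rw [← lintegral_iUnion (fun σ => hle k _ (hsm k σ))]
    · rw [show (⋃ σ, {ω | s k ω = σ}) = Set.univ from
        Set.eq_univ_of_forall fun ω => Set.mem_iUnion.2 ⟨s k ω, rfl⟩, setLIntegral_univ]
    · intro σ τ hne
      exact Set.disjoint_left.2 fun ω h1 h2 => hne (h1.symm.trans h2)
  have hbound : ∀ k, ∫⁻ ω, ENNReal.ofReal (visitWeight Q h m (s k ω) (Y k ω)) ∂P ≤ 1 := by
    intro k
    induction k with
    | zero =>
      calc ∫⁻ ω, ENNReal.ofReal (visitWeight Q h m (s 0 ω) (Y 0 ω)) ∂P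
          ≤ ∫⁻ ω, ENNReal.ofReal (visitWeight Q h m (some (∅, none)) (Y 0 ω)) ∂P :=
            lintegral_mono fun ω => ENNReal.ofReal_le_ofReal
              (visitWeight_step_le hQ h1 hoff hon _ _)
        _ ≤ 1 := by
          have : ¬ m ≤ 0 := by omega
          simp [visitWeight, this]
    | succ k ih =>
      calc ∫⁻ ω, ENNReal.ofReal (visitWeight Q h m (s (k + 1) ω) (Y (k + 1) ω)) ∂P
          ≤ ∫⁻ ω, ENNReal.ofReal (visitWeight Q h m (s k ω) (Y (k + 1) ω)) ∂P :=
            lintegral_mono fun ω => ENNReal.ofReal_le_ofReal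
              (visitWeight_step_le hQ h1 hoff hon _ _)
        _ = ∑' σ, ∫⁻ ω in {ω | s k ω = σ},
              ENNReal.ofReal (visitWeight Q h m (s k ω) (Y (k + 1) ω)) ∂P := hsplit k _
        _ = ∑' σ, ∫⁻ ω in {ω | s k ω = σ},
              ENNReal.ofReal (visitWeight Q h m σ (Y (k + 1) ω)) ∂P :=
            tsum_congr fun σ => setLIntegral_congr_fun (hle k _ (hsm k σ))
              fun ω (hω : s k ω = σ) => by simp only [hω]
        _ ≤ ∑' σ, ∫⁻ ω in {ω | s k ω = σ},
              ENNReal.ofReal (visitWeight Q h m σ (Y k ω)) ∂P :=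
            ENNReal.tsum_le_tsum fun σ => setLIntegral_visitWeight_le hQ h0 h1 (hYm k)
              (hYm (k + 1)) (fun B => hsub k B _ (hsm k σ)) σ
        _ = ∑' σ, ∫⁻ ω in {ω | s k ω = σ},
              ENNReal.ofReal (visitWeight Q h m (s k ω) (Y k ω)) ∂P :=
            tsum_congr fun σ => setLIntegral_congr_fun (hle k _ (hsm k σ))
              fun ω (hω : s k ω = σ) => by simp only [hω]
        _ = ∫⁻ ω, ENNReal.ofReal (visitWeight Q h m (s k ω) (Y k ω)) ∂P := (hsplit k _).symm
        _ ≤ 1 := ih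
  have hQ0 : 0 < Q := by linarith
  have hdone : MeasurableSet {ω | (s k ω).IsDone m} := by
    have : {ω | (s k ω).IsDone m} = ⋃ σ ∈ {σ : VisitState | σ.IsDone m}, {ω | s k ω = σ} := by
      ext ω; simp
    rw [this]
    exact MeasurableSet.biUnion (Set.to_countable _) fun σ _ => hle k _ (hsm k σ)
  -- Markov's inequality: the weight equals `Q^(m-1)` once the exploration is done.
  have hfin : ENNReal.ofReal (Q ^ (m - 1)) * P {ω | (s k ω).IsDone m} ≤ 1 := by
    refine le_trans ?_ (hbound k)
    rw [← setLIntegral_const]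
    refine le_trans (setLIntegral_mono' hdone fun ω hω => ?_) (setLIntegral_le_lintegral _ _)
    rw [visitWeight_of_isDone hω]
  rw [inv_pow, ENNReal.ofReal_inv_of_pos (by positivity), ENNReal.le_inv_iff_mul_le, mul_comm]
  exact hfin

end

/-! ### The walk jumps to nearest neighbours only -/

/-- The index of the last point of the grid of mesh `1 / (n + 1)` before `t`. -/
noncomputable def leftIdx (n : ℕ) (t : ℝ≥0) : ℕ := ⌈t * (n + 1)⌉₊ - 1

lemma leftIdx_add_one {n : ℕ} {t : ℝ≥0} (ht : 0 < t) : leftIdx n t + 1 = ⌈t * (n + 1)⌉₊ := by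
  have : 0 < ⌈t * (n + 1)⌉₊ := Nat.ceil_pos.2 (by positivity)
  unfold leftIdx
  omega

lemma leftIdx_lt {n : ℕ} {t : ℝ≥0} (ht : 0 < t) : (leftIdx n t : ℝ≥0) / (n + 1) < t := by
  rw [div_lt_iff₀ (by positivity), ← Nat.lt_ceil, ← leftIdx_add_one ht]
  exact Nat.lt_succ_self _

lemma le_leftIdx {n : ℕ} {t : ℝ≥0} (ht : 0 < t) :
    t ≤ ((leftIdx n t + 1 : ℕ) : ℝ≥0) / (n + 1) := by
  rw [le_div_iff₀ (by positivity), leftIdx_add_one ht]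
  exact Nat.le_ceil _

lemma leftIdx_eq {n k : ℕ} {t : ℝ≥0} (h1 : (k : ℝ≥0) / (n + 1) < t)
    (h2 : t ≤ ((k + 1 : ℕ) : ℝ≥0) / (n + 1)) : leftIdx n t = k := by
  have ht : 0 < t := (by positivity : (0 : ℝ≥0) ≤ _).trans_lt h1
  rw [div_lt_iff₀ (by positivity)] at h1
  rw [le_div_iff₀ (by positivity)] at h2
  have := leftIdx_add_one (n := n) ht
  have h3 := Nat.lt_ceil.2 h1
  have h4 := Nat.ceil_le.2 h2
  omega

lemma tendsto_leftIdx {t : ℝ≥0} (ht : 0 < t) :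
    Tendsto (fun n : ℕ => (leftIdx n t : ℝ≥0) / (n + 1)) atTop (𝓝[<] t) := by
  refine tendsto_nhdsWithin_iff.2 ⟨?_, Eventually.of_forall fun n => leftIdx_lt ht⟩
  have h0 := tendsto_one_div_add_atTop_nhds_zero_nat (𝕜 := ℝ≥0)
  have h : Tendsto (fun n : ℕ => t - 1 / ((n : ℝ≥0) + 1)) atTop (𝓝 t) := by
    simpa using (tendsto_const_nhds (x := t)).sub h0
  refine tendsto_of_tendsto_of_tendsto_of_le_of_le h tendsto_const_nhds (fun n => ?_)
    fun n => (leftIdx_lt ht).le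
  rw [tsub_le_iff_right, ← add_div]
  exact_mod_cast le_leftIdx ht

lemma tendsto_leftIdx_add_one {t : ℝ≥0} (ht : 0 < t) :
    Tendsto (fun n : ℕ => ((leftIdx n t + 1 : ℕ) : ℝ≥0) / (n + 1)) atTop (𝓝[≥] t) := by
  refine tendsto_nhdsWithin_iff.2 ⟨?_, Eventually.of_forall fun n => le_leftIdx ht⟩
  have h := ((tendsto_leftIdx ht).mono_right nhdsWithin_le_nhds).add
    (tendsto_one_div_add_atTop_nhds_zero_nat (𝕜 := ℝ≥0))
  rw [add_zero] at h
  refine h.congr fun n => ?_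
  rw [← add_div, Nat.cast_succ]

/-- The times at which a right-continuous path jumps away from `i` form a countable set. -/
lemma countable_jump_times {x : ℝ≥0 → ℤ × ℤ} (hx : ∀ t, ∀ᶠ s in 𝓝[≥] t, x s = x t) (i : ℤ × ℤ) :
    {t | (∀ᶠ s in 𝓝[<] t, x s = i) ∧ x t ≠ i}.Countable := by
  have h : ∀ t, ∃ u, t < u ∧ ∀ s ∈ Set.Ico t u, x s = x t := fun t => by
    obtain ⟨u, hu, hs⟩ := (mem_nhdsGE_iff_exists_Ico_subset).1 (hx t)
    exact ⟨u, hu, fun s h => hs h⟩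
  choose u hu hxu using h
  -- The path differs from `i` throughout `[t, u t)`, so it cannot jump away from `i` inside that
  -- interval. The intervals of distinct jump times are therefore disjoint.
  have key : ∀ t s, x t ≠ i → (∀ᶠ r in 𝓝[<] s, x r = i) → t < s → u t ≤ s := by
    intro t s ht hs hts
    by_contra! hlt
    have : (𝓝[<] s).NeBot := nhdsLT_neBot_of_exists_lt ⟨t, hts⟩
    obtain ⟨r, hr, hr'⟩ := (hs.and (Ioo_mem_nhdsLT hts)).exists
    exact ht ((hxu t r ⟨hr'.1.le, hr'.2.trans hlt⟩).symm.trans hr)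
  refine Set.PairwiseDisjoint.countable_of_Ioo (y := u) (fun t ht s hs hne => ?_) fun t _ => hu t
  refine Set.disjoint_left.2 fun r hr hr' => ?_
  rcases lt_or_gt_of_ne hne with h | h
  · exact absurd (hr'.1.trans hr.2) (not_lt.2 (key t s ht.2 hs.1 h))
  · exact absurd (hr.1.trans hr'.2) (not_lt.2 (key s t hs.2 ht.1 h))

/-- If nonnegative variables have means that tend to `0`, they are almost surely not eventually
at least `1`. -/
lemma measure_eq_zero_of_eventually_one_le {P : Measure Ω}
    {S : ℕ → Ω → ℝ} (hm : ∀ n, Measurable (S n)) (h0 : ∀ n ω, 0 ≤ S n ω)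
    (hi : ∀ n, Integrable (S n) P) (hlim : Tendsto (fun n => ∫ ω, S n ω ∂P) atTop (𝓝 0))
    {B : Set Ω} (hB : ∀ ω ∈ B, ∀ᶠ n in atTop, 1 ≤ S n ω) : P B = 0 := by
  have hm' : ∀ n, Measurable fun ω => ENNReal.ofReal (S n ω) := fun n => (hm n).ennreal_ofReal
  have hF : ∫⁻ ω, liminf (fun n => ENNReal.ofReal (S n ω)) atTop ∂P ≤
      liminf (fun n => ∫⁻ ω, ENNReal.ofReal (S n ω) ∂P) atTop := lintegral_liminf_le hm'
  have hl : Tendsto (fun n => ∫⁻ ω, ENNReal.ofReal (S n ω) ∂P) atTop (𝓝 0) := by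
    have := (ENNReal.continuous_ofReal.tendsto 0).comp hlim
    rw [ENNReal.ofReal_zero] at this
    refine this.congr fun n => ?_
    exact ofReal_integral_eq_lintegral_ofReal (hi n) (Eventually.of_forall (h0 n))
  rw [hl.liminf_eq, nonpos_iff_eq_zero, lintegral_eq_zero_iff (Measurable.liminf hm')] at hF
  refine measure_mono_null (fun ω hω => ?_) hF
  have h1 : 1 ≤ liminf (fun n => ENNReal.ofReal (S n ω)) atTop :=
    le_liminf_of_le (by isBoundedDefault) ((hB ω hω).mono fun n hn => by
      rw [← ENNReal.ofReal_one]; exact ENNReal.ofReal_le_ofReal hn)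
  intro h
  have h : liminf (fun n => ENNReal.ofReal (S n ω)) atTop = 0 := h
  simp [h] at h1

section

variable {A : Set (ℤ × ℤ)} {a : ℝ≥0 → Ω → ℤ × ℤ → ℤ × ℤ → ℝ} {X : ℝ≥0 → Ω → ℤ × ℤ} {c : ℝ}
  {i₀ : ℤ × ℤ} {ℱ : Filtration ℝ≥0 mΩ} {P : Measure Ω}

/-- The indicator function of the sites that cannot be reached from `i` by one jump. -/
noncomputable def farFun (i j : ℤ × ℤ) : ℝ := if j = i ∨ j ∈ nbrs i then 0 else 1

lemma farFun_nonneg (i j : ℤ × ℤ) : 0 ≤ farFun i j := by unfold farFun; split_ifs <;> simp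

lemma abs_farFun_le (i j : ℤ × ℤ) : |farFun i j| ≤ 1 := by unfold farFun; split_ifs <;> simp

lemma killedGen_farFun (A : Set (ℤ × ℤ)) (a : ℤ × ℤ → ℤ × ℤ → ℝ) (i : ℤ × ℤ) :
    killedGen A a (farFun i) i = 0 := by
  unfold killedGen
  split_ifs
  · rfl
  · refine Finset.sum_eq_zero fun j hj => ?_
    simp [farFun, hj]

/-- The compensator increments of `farFun i` over the grid intervals that start at `i`. -/
noncomputable def farComp (A : Set (ℤ × ℤ)) (a : ℝ≥0 → Ω → ℤ × ℤ → ℤ × ℤ → ℝ)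
    (X : ℝ≥0 → Ω → ℤ × ℤ) (i : ℤ × ℤ) (N n : ℕ) (ω : Ω) : ℝ :=
  ∑ k ∈ Finset.range (N * (n + 1)), {ω | X ((k : ℝ≥0) / (n + 1)) ω = i}.indicator
    (fun ω => compensator A a X (farFun i) (((k + 1 : ℕ) : ℝ≥0) / (n + 1)) ω -
      compensator A a X (farFun i) ((k : ℝ≥0) / (n + 1)) ω) ω

-- Written as one integral over `[0, N]`, the sum is amenable to dominated convergence as the mesh
-- shrinks.
open Classical in
lemma farComp_eq (hc : 1 ≤ c) (ha : EllipticRates c a) (i : ℤ × ℤ) (N n : ℕ) {ω : Ω}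
    (hX : ∀ t, ∀ᶠ s in 𝓝[≥] t, X s ω = X t ω) :
    farComp A a X i N n ω = ∫ s in (0 : ℝ)..N,
      if X ((leftIdx n s.toNNReal : ℝ≥0) / (n + 1)) ω = i then
        killedGen A (a s.toNNReal ω) (farFun i) (X s.toNNReal ω) else 0 := by
  set φ : ℝ → ℝ := fun s => killedGen A (a s.toNNReal ω) (farFun i) (X s.toNNReal ω)
  have hφ : ∀ u v, IntervalIntegrable φ volume u v :=
    intervalIntegrable_killedGen hc ha (abs_farFun_le i) hX
  set ψ : ℝ → ℝ := fun s =>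
    if X ((leftIdx n s.toNNReal : ℝ≥0) / (n + 1)) ω = i then φ s else 0 with hψ
  have hcong : ∀ k : ℕ, ∀ s ∈ Set.Ioc ((((k : ℝ≥0) / (n + 1) : ℝ≥0)) : ℝ)
      (((((k + 1 : ℕ) : ℝ≥0) / (n + 1) : ℝ≥0)) : ℝ),
      (if X ((k : ℝ≥0) / (n + 1)) ω = i then φ s else 0) = ψ s := by
    intro k s hs
    have h1 : (k : ℝ≥0) / (n + 1) < s.toNNReal := Real.lt_toNNReal_iff_coe_lt.2 hs.1
    have h2 : s.toNNReal ≤ ((k + 1 : ℕ) : ℝ≥0) / (n + 1) := Real.toNNReal_le_iff_le_coe.2 hs.2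
    simp only [hψ, leftIdx_eq h1 h2]
  have hle : ∀ k : ℕ, ((((k : ℝ≥0) / (n + 1) : ℝ≥0)) : ℝ) ≤
      (((((k + 1 : ℕ) : ℝ≥0) / (n + 1) : ℝ≥0)) : ℝ) := fun k => by
    apply NNReal.coe_le_coe.2
    gcongr
    omega
  have hint : ∀ k < N * (n + 1), IntervalIntegrable ψ volume (((k : ℝ≥0) / (n + 1) : ℝ≥0) : ℝ)
      ((((k + 1 : ℕ) : ℝ≥0) / (n + 1) : ℝ≥0) : ℝ) := by
    intro k _
    refine IntervalIntegrable.congr (f := fun s => if X ((k : ℝ≥0) / (n + 1)) ω = i then φ s else 0)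
      ?_ ?_
    · rw [Set.uIoc_of_le (hle k)]
      exact fun s hs => hcong k s hs
    · split_ifs
      · exact hφ _ _
      · exact intervalIntegrable_const
  have hsum := intervalIntegral.sum_integral_adjacent_intervals hint
  have h0 : ((((0 : ℕ) : ℝ≥0) / ((n : ℝ≥0) + 1) : ℝ≥0) : ℝ) = 0 := by simp
  have hN : ((((N * (n + 1) : ℕ) : ℝ≥0) / ((n : ℝ≥0) + 1) : ℝ≥0) : ℝ) = N := by
    push_cast
    field_simp
  rw [h0, hN] at hsum
  rw [← hsum]
  refine Finset.sum_congr rfl fun k _ => ?_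
  have hi := compensator_sub (A := A) hc ha (abs_farFun_le i) hX ((k : ℝ≥0) / (n + 1))
    (((k + 1 : ℕ) : ℝ≥0) / (n + 1))
  rw [Set.indicator_apply]
  simp only [Set.mem_ofPred_eq]
  rw [hi, ← intervalIntegral.integral_congr_ae (f := fun s =>
    if X ((k : ℝ≥0) / (n + 1)) ω = i then φ s else 0) (g := ψ)]
  · split_ifs
    · rfl
    · simp
  · rw [Set.uIoc_of_le (hle k)]
    exact Eventually.of_forall fun s hs => hcong k s hs

lemma abs_farComp_le (hc : 1 ≤ c) (ha : EllipticRates c a) (i : ℤ × ℤ) (N n : ℕ) {ω : Ω}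
    (hX : ∀ t, ∀ᶠ s in 𝓝[≥] t, X s ω = X t ω) : |farComp A a X i N n ω| ≤ 8 * c * N := by
  classical
  rw [farComp_eq hc ha i N n hX]
  have := intervalIntegral.norm_integral_le_of_norm_le_const (a := 0) (b := N) (C := 8 * c)
    (f := fun s : ℝ => if X ((leftIdx n s.toNNReal : ℝ≥0) / (n + 1)) ω = i then
        killedGen A (a s.toNNReal ω) (farFun i) (X s.toNNReal ω) else 0) fun s _ => by
      split_ifs
      · have := abs_killedGen_le (A := A) hc (fun i j hj => ha.bounds s.toNNReal ω i j hj)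
          (abs_farFun_le i) (X s.toNNReal ω)
        rwa [mul_one] at this
      · simp; linarith
  simpa using this

/-- For fixed `s` the left grid value is eventually the left limit at `s`. If that is not `i`, the
integrand vanishes. If it is `i`, then `X s = i` off a countable set of jump times, and the
generator of `farFun i` vanishes at `i`. -/
lemma tendsto_farComp (hc : 1 ≤ c) (ha : EllipticRates c a) (i : ℤ × ℤ) (N : ℕ) {ω : Ω}
    (hX : ∀ t, ∀ᶠ s in 𝓝[≥] t, X s ω = X t ω)
    (hX' : ∀ t, ∃ k, ∀ᶠ s in 𝓝[<] t, X s ω = k) :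
    Tendsto (fun n => farComp A a X i N n ω) atTop (𝓝 0) := by
  classical
  simp_rw [farComp_eq hc ha i N _ hX]
  refine Tendsto.mono_right (y := 𝓝 (∫ _s in (0 : ℝ)..N, (0 : ℝ))) ?_ (by simp)
  refine intervalIntegral.tendsto_integral_filter_of_dominated_convergence (μ := volume)
    (l := (atTop : Filter ℕ)) (f := fun _ => (0 : ℝ)) (fun _ => 8 * c)
    (Eventually.of_forall fun n => ?_) (Eventually.of_forall fun n => ?_)
    (intervalIntegrable_const (μ := volume)) ?_
  · refine Measurable.aestronglyMeasurable (Measurable.ite ?_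
      (measurable_killedGen_path ha _ hX) measurable_const)
    have : Measurable fun s : ℝ => X ((leftIdx n s.toNNReal : ℝ≥0) / (n + 1)) ω :=
      (measurable_from_nat (f := fun k : ℕ => X (((k - 1 : ℕ) : ℝ≥0) / (n + 1)) ω)).comp
        (Nat.measurable_ceil.comp (measurable_real_toNNReal.mul_const _))
    exact this (measurableSet_singleton i)
  · refine Eventually.of_forall fun s _ => ?_
    split_ifs
    · have := abs_killedGen_le (A := A) hc (fun i j hj => ha.bounds s.toNNReal ω i j hj)
        (abs_farFun_le i) (X s.toNNReal ω)
      rwa [mul_one] at this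
    · simp; linarith
  · have hcount := (countable_jump_times hX i).image ((↑) : ℝ≥0 → ℝ)
    filter_upwards [hcount.ae_notMem volume] with s hs hs0
    rw [Set.uIoc_of_le (Nat.cast_nonneg N)] at hs0
    have hpos : 0 < s.toNNReal := Real.toNNReal_pos.2 hs0.1
    refine tendsto_const_nhds.congr' ?_
    obtain ⟨k, hk⟩ := hX' s.toNNReal
    filter_upwards [(tendsto_leftIdx hpos).eventually hk] with n hn
    rw [hn]
    split_ifs with hki
    · subst hki
      by_cases h : X s.toNNReal ω = k
      · rw [h, killedGen_farFun]
      · exact absurd ⟨s.toNNReal, ⟨hk, h⟩, Real.coe_toNNReal s hs0.1.le⟩ hs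
    · rfl

variable [IsProbabilityMeasure P]

/-- Almost surely all jumps of the walk lead to nearest neighbours. -/
lemma IsKilledWalk.ae_jump_mem_nbrs (hX : IsKilledWalk A a i₀ ℱ X P) (hc : 1 ≤ c)
    (ha : EllipticRates c a) :
    ∀ᵐ ω ∂P, ∀ i t, 0 < t → (∀ᶠ s in 𝓝[<] t, X s ω = i) → X t ω = i ∨ X t ω ∈ nbrs i := by
  rw [ae_all_iff]
  intro i
  suffices h : ∀ N : ℕ, ∀ᵐ ω ∂P, ∀ t : ℝ≥0, 0 < t → t ≤ N → (∀ᶠ s in 𝓝[<] t, X s ω = i) →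
      X t ω = i ∨ X t ω ∈ nbrs i by
    filter_upwards [ae_all_iff.2 h] with ω hω t ht
    obtain ⟨N, hN⟩ := exists_nat_ge t
    exact hω N t ht hN
  intro N
  set E : ℕ → ℕ → Set Ω := fun n k => {ω | X ((k : ℝ≥0) / (n + 1)) ω = i} with hE
  have hEm : ∀ n k : ℕ, MeasurableSet[ℱ ((k : ℝ≥0) / (n + 1))] (E n k) := fun n k =>
    hX.adapted _ (measurableSet_singleton i)
  have hEm' : ∀ n k : ℕ, MeasurableSet (E n k) := fun n k => ℱ.le _ _ (hEm n k)
  set S : ℕ → Ω → ℝ := fun n ω => ∑ k ∈ Finset.range (N * (n + 1)), (E n k).indicator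
    (fun ω => farFun i (X (((k + 1 : ℕ) : ℝ≥0) / (n + 1)) ω)) ω with hS
  have hfm : ∀ t, Measurable fun ω => farFun i (X t ω) := fun t =>
    (measurable_of_countable (farFun i)).comp (hX.measurable t)
  have hSi : ∀ n, Integrable (S n) P := fun n => integrable_finsetSum _ fun k _ =>
    (hX.integrable_comp (abs_farFun_le i) _).indicator (hEm' n k)
  have hCi : ∀ n k : ℕ, Integrable ((E n k).indicator fun ω =>
      compensator A a X (farFun i) (((k + 1 : ℕ) : ℝ≥0) / (n + 1)) ω -
        compensator A a X (farFun i) ((k : ℝ≥0) / (n + 1)) ω) P := fun n k =>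
    ((hX.integrable_compensator (abs_farFun_le i) _).sub
      (hX.integrable_compensator (abs_farFun_le i) _)).indicator (hEm' n k)
  -- On `E n k` the walk starts the grid step at `i`, where `farFun i` is zero, so the summand is an
  -- increment and the martingale identity applies.
  have hSC : ∀ n, ∫ ω, S n ω ∂P = ∫ ω, farComp A a X i N n ω ∂P := by
    intro n
    simp only [hS, farComp]
    rw [integral_finsetSum _ fun k _ =>
        (hX.integrable_comp (abs_farFun_le i) _).indicator (hEm' n k),
      integral_finsetSum _ fun k _ => hCi n k]
    refine Finset.sum_congr rfl fun k _ => ?_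
    rw [integral_indicator (hEm' n k), integral_indicator (hEm' n k),
      ← hX.setIntegral_sub (abs_farFun_le i) _ (hEm n k)]
    · refine setIntegral_congr_fun (hEm' n k) fun ω hω => ?_
      have : X ((k : ℝ≥0) / (n + 1)) ω = i := hω
      simp [this, farFun]
    · gcongr
      omega
  have hlim : Tendsto (fun n => ∫ ω, S n ω ∂P) atTop (𝓝 0) := by
    simp_rw [hSC]
    rw [show (0 : ℝ) = ∫ _ω : Ω, (0 : ℝ) ∂P by simp]
    refine tendsto_integral_of_dominated_convergence (fun _ => 8 * c * N) (fun n => ?_)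
      (integrable_const _) (fun n => Eventually.of_forall fun ω => ?_)
      (Eventually.of_forall fun ω => ?_)
    · exact (integrable_finsetSum _ fun k _ => hCi n k).aestronglyMeasurable
    · exact abs_farComp_le hc ha i N n (hX.right_cont ω)
    · exact tendsto_farComp hc ha i N (hX.right_cont ω) (hX.left_lim ω)
  refine measure_eq_zero_of_eventually_one_le (S := S) (fun n => ?_) (fun n ω => ?_) hSi hlim ?_
  · exact Finset.measurable_sum _ fun k _ => (hfm _).indicator (hEm' n k)
  · exact Finset.sum_nonneg fun k _ => Set.indicator_nonneg (fun _ _ => farFun_nonneg _ _) _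
  · intro ω hω
    simp only [Set.mem_compl_iff, Set.mem_ofPred_eq, not_forall] at hω
    obtain ⟨t, ht, htN, hl, hbad⟩ := hω
    -- On fine grids the interval around a forbidden jump starts at `i` and ends at `X t`, so its
    -- summand equals `1`.
    filter_upwards [(tendsto_leftIdx ht).eventually hl,
      (tendsto_leftIdx_add_one ht).eventually (hX.right_cont ω t)] with n h1 h2
    have hk : leftIdx n t ∈ Finset.range (N * (n + 1)) := by
      rw [Finset.mem_range, ← Nat.succ_le_iff, Nat.succ_eq_add_one, leftIdx_add_one ht,
        Nat.ceil_le]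
      push_cast
      gcongr
    refine le_trans ?_ (Finset.single_le_sum (fun k _ => Set.indicator_nonneg
      (fun _ _ => farFun_nonneg _ _) _) hk)
    rw [Set.indicator_of_mem (by exact h1), h2, farFun, if_neg hbad]

end

/-! ### From trajectories of the walk to paths of the renormalized lattice -/

/-- `y` can be reached from the origin of the renormalized lattice by a path inside `V`. -/
def ReachableIn (l : ℕ) (V : Set (ℤ × ℤ)) (y : ℤ × ℤ) : Prop :=
  ∃ w : (renGraph l).Walk 0 y, ∀ u ∈ w.support, u ∈ V

lemma ReachableIn.of_adj {l : ℕ} {V V' : Set (ℤ × ℤ)} {y y' : ℤ × ℤ} (h : ReachableIn l V y)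
    (hadj : (renGraph l).Adj y y') (hV : V ⊆ V') (hy : y' ∈ V') : ReachableIn l V' y' := by
  obtain ⟨w, hw⟩ := h
  refine ⟨w.concat hadj, fun u hu => ?_⟩
  rw [SimpleGraph.Walk.support_concat, List.mem_append, List.mem_singleton] at hu
  rcases hu with hu | rfl
  · exact hV (hw u hu)
  · exact hy

/-- Connectedness of `[0, τ]` replaces an enumeration of the jumps: near each time, the blocks
occupied just before and just after coincide with or are adjacent to the present one, so
reachability spreads from time `0`. -/
lemma reachableIn_path {l : ℕ} {x : ℝ≥0 → ℤ × ℤ} (hx : ∀ t, ∀ᶠ s in 𝓝[≥] t, x s = x t)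
    (hx' : ∀ t, ∃ k, ∀ᶠ s in 𝓝[<] t, x s = k)
    (hjump : ∀ i t, 0 < t → (∀ᶠ s in 𝓝[<] t, x s = i) → x t = i ∨ x t ∈ nbrs i)
    (h0 : x 0 = 0) (τ : ℝ≥0) :
    ReachableIn l {B | ∃ s ≤ τ, blockCenter l (x s) = B} (blockCenter l (x τ)) := by
  set V := {B | ∃ s ≤ τ, blockCenter l (x s) = B} with hV
  have hbase : ReachableIn l V (blockCenter l (x 0)) := by
    rw [h0, blockCenter_zero]
    refine ⟨.nil, fun u hu => ?_⟩
    rw [SimpleGraph.Walk.support_nil, List.mem_singleton] at hu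
    exact ⟨0, zero_le, by rw [h0, blockCenter_zero, hu]⟩
  refine (IsPreconnected.induction₂ (s := Set.Icc 0 τ) isPreconnected_Icc
    (fun t s => ReachableIn l V (blockCenter l (x t)) ↔ ReachableIn l V (blockCenter l (x s)))
    (fun t ht => ?_) (fun _ _ _ _ _ _ h1 h2 => h1.trans h2) (fun _ _ _ _ h => h.symm)
    (Set.left_mem_Icc.2 zero_le) (Set.right_mem_Icc.2 zero_le)).1 hbase
  rw [eventually_nhdsWithin_iff, ← nhdsLT_sup_nhdsGE, eventually_sup]
  refine ⟨?_, (hx t).mono fun s hs _ => by rw [hs]⟩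
  rcases eq_or_ne t 0 with rfl | ht0
  · rw [show Set.Iio (0 : ℝ≥0) = ∅ from Set.Iio_bot]
    simp
  obtain ⟨k, hk⟩ := hx' t
  filter_upwards [hk] with s hs hsτ
  have hmt : blockCenter l (x t) ∈ V := ⟨t, ht.2, rfl⟩
  have hms : blockCenter l (x s) ∈ V := ⟨s, hsτ.2, rfl⟩
  rcases hjump k t (pos_iff_ne_zero.2 ht0) hk with h | h
  · rw [h, hs]
  · rw [← hs] at h
    rcases renGraph_adj_blockCenter (l := l) h with h | h
    · rw [h]
    · exact ⟨fun h' => h'.of_adj h.symm subset_rfl hms, fun h' => h'.of_adj h subset_rfl hmt⟩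

lemma mem_renBox_zero_iff {l : ℕ} {r : ℝ} {y : ℤ × ℤ} :
    y ∈ renBox l 0 r ↔ y ∈ renLattice l ∧ ((|y.1| : ℤ) : ℝ) ≤ l * r ∧ ((|y.2| : ℤ) : ℝ) ≤ l * r := by
  simp only [renBox, Set.mem_ofPred_eq, Prod.norm_def, Int.norm_eq_abs, sup_le_iff]
  simp

/-- A path that leaves the box of the renormalized lattice has a part that leads to its
boundary. -/
lemma exists_walk_renBoundary {l : ℕ} {r : ℝ} {u y : ℤ × ℤ} (w : (renGraph l).Walk u y)
    (hu : u ∈ renBox l 0 r) (hy : y ∉ renBox l 0 r) :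
    ∃ y' ∈ renBoundary l 0 r, ∃ w' : (renGraph l).Walk u y', ∀ v ∈ w'.support, v ∈ w.support := by
  induction w with
  | nil => exact absurd hu hy
  | @cons u v y h p ih =>
    by_cases hv : v ∈ renBox l 0 r
    · obtain ⟨y', hy', w', hw'⟩ := ih hv hy
      refine ⟨y', hy', .cons h w', fun a ha => ?_⟩
      rw [SimpleGraph.Walk.support_cons, List.mem_cons] at ha ⊢
      exact ha.imp_right (hw' a)
    · refine ⟨v, ⟨hv, u, hu, h⟩, .cons h .nil, fun a ha => ?_⟩
      rw [SimpleGraph.Walk.support_cons, SimpleGraph.Walk.support_nil, List.mem_cons,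
        List.mem_singleton] at ha
      rw [SimpleGraph.Walk.support_cons, List.mem_cons]
      rcases ha with rfl | rfl
      · exact .inl rfl
      · exact .inr p.start_mem_support

/-- The block of a site outside a box has a neighbour outside the renormalized box. -/
lemma exists_adj_notMem_renBox {l : ℕ} {r : ℝ} {y : ℤ × ℤ} (hy : y ∉ box 0 (r * l)) :
    ∃ y', (renGraph l).Adj (blockCenter l y) y' ∧ y' ∉ renBox l 0 r := by
  have hC := blockCenter_mem_renLattice l y
  have s1 := abs_le.1 (blockCoord_spec l y.1)
  have s2 := abs_le.1 (blockCoord_spec l y.2)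
  set L : ℤ := 2 * (l : ℤ) + 1 with hL
  have hL0 : 0 ≤ L := by omega
  have lt_abs' : ∀ n : ℤ, ∀ ρ : ℝ, ρ < ((|n| : ℤ) : ℝ) → ρ < (n : ℝ) ∨ ρ < ((-n : ℤ) : ℝ) := by
    intro n ρ h
    rcases abs_choice n with h' | h' <;> rw [h'] at h
    · exact .inl h
    · exact .inr h
  have lt_of : ∀ (m n : ℤ) (ρ : ℝ), ρ < (m : ℝ) → m ≤ n → ρ < ((|n| : ℤ) : ℝ) := fun m n ρ h h' =>
    h.trans_le (by exact_mod_cast h'.trans (le_abs_self n))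
  have lt_of' : ∀ (m n : ℤ) (ρ : ℝ), ρ < (m : ℝ) → m ≤ -n → ρ < ((|n| : ℤ) : ℝ) :=
    fun m n ρ h h' => h.trans_le (by exact_mod_cast h'.trans (neg_le_abs n))
  rw [mem_box_iff, not_and_or, not_le, not_le, mul_comm] at hy
  simp only [Prod.fst_zero, Prod.snd_zero, zero_sub, abs_neg] at hy
  simp only [mem_renBox_zero_iff, not_and_or, not_le]
  -- The centre is within `l` of `y` and may still lie in the renormalized box; an outward step of
  -- length `2l+1` passes beyond `y`.
  rcases hy with hy | hy <;> rcases lt_abs' _ _ hy with hy | hy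
  · refine ⟨(blockCoord l y.1 + L, blockCoord l y.2), ⟨hC, ⟨dvd_add hC.1 dvd_rfl, hC.2⟩, ?_⟩,
      .inr (.inl (lt_of _ _ _ hy ?_))⟩
    · simpa [blockCenter, abs_of_nonneg hL0] using hL
    · simp only; omega
  · refine ⟨(blockCoord l y.1 - L, blockCoord l y.2), ⟨hC, ⟨dvd_sub hC.1 dvd_rfl, hC.2⟩, ?_⟩,
      .inr (.inl (lt_of' _ _ _ hy ?_))⟩
    · simpa [blockCenter, abs_of_nonneg hL0] using hL
    · simp only; omega
  · refine ⟨(blockCoord l y.1, blockCoord l y.2 + L), ⟨hC, ⟨hC.1, dvd_add hC.2 dvd_rfl⟩, ?_⟩,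
      .inr (.inr (lt_of _ _ _ hy ?_))⟩
    · simpa [blockCenter, abs_of_nonneg hL0] using hL
    · simp only; omega
  · refine ⟨(blockCoord l y.1, blockCoord l y.2 - L), ⟨hC, ⟨hC.1, dvd_sub hC.2 dvd_rfl⟩, ?_⟩,
      .inr (.inr (lt_of' _ _ _ hy ?_))⟩
    · simpa [blockCenter, abs_of_nonneg hL0] using hL
    · simp only; omega

/-- If `A` is dirty, a trajectory that leaves the box visits many blocks that meet `A`. -/
lemma exists_visited_blocks {l : ℕ} {r ε : ℝ} (hr : 0 ≤ r) {A : Set (ℤ × ℤ)}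
    (hA : IsDirty l r ε A) {V : Set (ℤ × ℤ)} {y : ℤ × ℤ} (hy : y ∉ box 0 (r * l))
    (hV : ReachableIn l V (blockCenter l y)) (hVl : V ⊆ renLattice l) :
    ∃ F : Finset (ℤ × ℤ), ε * r - 1 ≤ F.card ∧
      ∀ B ∈ F, B ∈ V ∧ ∃ z ∈ A, blockCenter l z = B := by
  classical
  obtain ⟨y', hadj, hy'⟩ := exists_adj_notMem_renBox (r := r) hy
  obtain ⟨w, hw⟩ := hV.of_adj hadj (Set.subset_insert y' V) (Set.mem_insert _ _)
  have h0 : (0 : ℤ × ℤ) ∈ renBox l 0 r := by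
    rw [mem_renBox_zero_iff]
    refine ⟨⟨dvd_zero _, dvd_zero _⟩, ?_, ?_⟩ <;> simp <;> positivity
  obtain ⟨y'', hy'', w', hw'⟩ := exists_walk_renBoundary w h0 hy'
  set T := {x | x ∈ w'.support ∧ (box x l ∩ A).Nonempty} with hT
  have hTfin : T.Finite := (List.finite_toSet w'.support).subset fun x hx => hx.1
  have hcard : ε * r ≤ (T.ncard : ℝ) := by
    by_contra! h
    exact hA ⟨y'', hy'', w', h⟩
  -- The appended block `y'` need not have been visited; discarding it accounts for the `-1`.
  refine ⟨hTfin.toFinset.erase y', ?_, fun B hB => ?_⟩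
  · have h1 := Finset.pred_card_le_card_erase (s := hTfin.toFinset) (a := y')
    rw [← Set.ncard_eq_toFinset_card T hTfin] at h1
    have h2 : (T.ncard : ℝ) ≤ ((hTfin.toFinset.erase y').card : ℝ) + 1 := by
      exact_mod_cast (by omega : T.ncard ≤ (hTfin.toFinset.erase y').card + 1)
    linarith
  · rw [Finset.mem_erase, Set.Finite.mem_toFinset] at hB
    obtain ⟨hne, hB1, z, hz, hzA⟩ := hB
    have hBV : B ∈ V := (hw B (hw' B hB1)).resolve_left hne
    exact ⟨hBV, z, hzA, blockCenter_eq_of_mem_box (hVl hBV) hz⟩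

/-! ### The exit probability -/

lemma exists_const_right {x : ℝ≥0 → ℤ × ℤ} (hx : ∀ t, ∀ᶠ s in 𝓝[≥] t, x s = x t) (t : ℝ≥0) :
    ∃ u, t < u ∧ ∀ s, t ≤ s → s < u → x s = x t := by
  obtain ⟨u, hu, hs⟩ := (mem_nhdsGE_iff_exists_Ico_subset).1 (hx t)
  exact ⟨u, hu, fun s h1 h2 => hs ⟨h1, h2⟩⟩

/-- Right-continuity makes the infimum of the exit times an exit time itself. -/
lemma exists_of_mem_exitsBefore {X : ℝ≥0 → Ω → ℤ × ℤ} {A : Set (ℤ × ℤ)} {ρ : ℝ}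
    {ω : Ω} (hX : ∀ t, ∀ᶠ s in 𝓝[≥] t, X s ω = X t ω) (h : ω ∈ exitsBefore X A ρ) :
    ∃ τ, X τ ω ∉ box 0 ρ ∧ ∀ s ≤ τ, X s ω ∉ A := by
  have h : hittingAfter X (box 0 ρ)ᶜ 0 ω < hittingAfter X A 0 ω := h
  by_cases hex : ∃ j, (0 : ℝ≥0) ≤ j ∧ X j ω ∈ (box 0 ρ)ᶜ
  · rw [hittingAfter, if_pos hex] at h
    set T := {i : ℝ≥0 | 0 ≤ i ∧ X i ω ∈ (box 0 ρ)ᶜ} with hT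
    refine ⟨sInf T, ?_, fun s hs => ?_⟩
    · obtain ⟨u, hu, hxu⟩ := exists_const_right hX (sInf T)
      obtain ⟨t, ht, htu⟩ := exists_lt_of_csInf_lt (s := T) hex hu
      rw [← hxu t (csInf_le (OrderBot.bddBelow T) ht) htu]
      exact ht.2
    · exact notMem_of_lt_hittingAfter (lt_of_le_of_lt (WithTop.coe_le_coe.2 hs) h) zero_le
  · rw [hittingAfter, if_neg hex] at h
    exact absurd h not_top_lt

/-- Visits along a trajectory are seen on all sufficiently fine grids. -/
lemma eventually_isDone {x : ℝ≥0 → ℤ × ℤ} (hx : ∀ t, ∀ᶠ s in 𝓝[≥] t, x s = x t)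
    {A D : Set (ℤ × ℤ)} {b : ℤ × ℤ → ℤ × ℤ} {m : ℕ} {τ : ℝ≥0} (hA : ∀ s ≤ τ, x s ∉ A)
    {F : Finset (ℤ × ℤ)} (hFD : ∀ B ∈ F, B ∈ D) (hF : ∀ B ∈ F, ∃ s ≤ τ, b (x s) = B)
    (hm : m ≤ F.card) :
    ∀ᶠ n : ℕ in atTop,
      (visitState A D b m (fun k => x ((k : ℝ≥0) / (n + 1))) (n * (n + 1))).IsDone m := by
  -- Grid points that witness a visit lie to its right and may exceed `τ`; on `[τ, u)` the path is
  -- constant and still avoids `A`.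
  obtain ⟨u, hu, hxu⟩ := exists_const_right hx τ
  have hu0 : 0 < u := zero_le.trans_lt hu
  have hAu : ∀ s < u, x s ∉ A := fun s hs => by
    rcases le_total s τ with h | h
    · exact hA s h
    · rw [hxu s h hs]; exact hA τ le_rfl
  choose! s hsτ hs using hF
  have hev : ∀ B ∈ F, ∀ᶠ n : ℕ in atTop,
      x (((⌊s B * (n + 1)⌋₊ + 1 : ℕ) : ℝ≥0) / (n + 1)) = x (s B) ∧
        ((⌊s B * (n + 1)⌋₊ + 1 : ℕ) : ℝ≥0) / (n + 1) < u := fun B hB =>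
    ((tendsto_rightGrid (s B)).eventually (hx (s B))).and
      (((tendsto_rightGrid (s B)).mono_right nhdsWithin_le_nhds).eventually
        (gt_mem_nhds ((hsτ B hB).trans_lt hu)))
  filter_upwards [(Filter.eventually_all_finset F).2 hev,
    tendsto_natCast_atTop_atTop.eventually_ge_atTop u] with n hn hnu
  refine visitState_isDone (k := leftIdx n u) ?_ (fun j hj => hAu _ ?_) hFD (fun B hB => ?_) hm
  · have := leftIdx_add_one (n := n) hu0
    have h2 : ⌈u * (n + 1)⌉₊ ≤ n * (n + 1) := by
      rw [Nat.ceil_le]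
      push_cast
      gcongr
    omega
  · refine lt_of_le_of_lt ?_ (leftIdx_lt (n := n) hu0)
    gcongr
  · refine ⟨⌊s B * (n + 1)⌋₊ + 1, ?_, ?_⟩
    · have h1 := (hn B hB).2
      rw [div_lt_iff₀ (by positivity), ← Nat.lt_ceil, ← leftIdx_add_one hu0] at h1
      omega
    · simp only [(hn B hB).1, hs B hB]

/-- The walk leaves the box before it is killed with probability at most `(1 - p) ^ (m - 1)`, where
`m` bounds from below the number of blocks meeting `A` that it has to visit, and `p` bounds from
below the probability to be killed at the first visit to such a block. -/
lemma IsKilledWalk.measure_exitsBefore_le {A : Set (ℤ × ℤ)}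
    {a : ℝ≥0 → Ω → ℤ × ℤ → ℤ × ℤ → ℝ} {X : ℝ≥0 → Ω → ℤ × ℤ} {c : ℝ} {ℱ : Filtration ℝ≥0 mΩ}
    {P : Measure Ω} [IsProbabilityMeasure P] (hX : IsKilledWalk A a 0 ℱ X P) (hc : 1 ≤ c)
    (ha : EllipticRates c a) {l m : ℕ} (hl : 1 ≤ l) (hm : 1 ≤ m) {r ε : ℝ} (hr : 0 ≤ r)
    (hA : IsDirty l r ε A) (hmr : (m : ℝ) < ε * r) :
    P (exitsBefore X A (r * l)) ≤
      ENNReal.ofReal ((1 - ((1 + 4 * c ^ 2)⁻¹) ^ (4 * l)) ^ (m - 1)) := by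
  classical
  set κ : ℝ := (1 + 4 * c ^ 2)⁻¹ with hκ
  have hκ0 : 0 < κ := by positivity
  have hκ1 : κ < 1 := inv_lt_one_of_one_lt₀ (by nlinarith)
  set p : ℝ := κ ^ (4 * l) with hp
  have hp0 : 0 < p := by positivity
  have hp1 : p < 1 := pow_lt_one₀ hκ0.le hκ1 (by omega)
  set D : Set (ℤ × ℤ) := {B | ∃ z ∈ A, blockCenter l z = B} with hD
  -- The barrier of a marked block is built around one chosen site of `A` in it.
  set h : ℤ × ℤ → ℤ × ℤ → ℝ := fun B y => if hB : B ∈ D then blockFun l κ hB.choose y else 0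
    with hh
  have h0 : ∀ B y, 0 ≤ h B y := fun B y => by
    simp only [hh]
    split_ifs
    · exact blockFun_nonneg hκ0.le _ _
    · exact le_rfl
  have h1 : ∀ B y, h B y ≤ 1 := fun B y => by
    simp only [hh]
    split_ifs
    · exact blockFun_le_one hκ0.le hκ1.le _ _
    · exact zero_le_one
  have hoff : ∀ B y, blockCenter l y ≠ B → h B y = 0 := fun B y hy => by
    simp only [hh]
    split_ifs with hB
    · rw [blockFun, if_neg]
      rwa [hB.choose_spec.2]
    · rfl
  have hon : ∀ y, blockCenter l y ∈ D → (1 - p)⁻¹ * (1 - h (blockCenter l y) y) ≤ 1 :=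
    fun y hy => by
      have : p ≤ h (blockCenter l y) y := by
        simp only [hh, dif_pos hy]
        exact le_blockFun hκ0.le hκ1.le hy.choose_spec.2.symm
      rw [inv_mul_le_one₀ (by linarith)]
      linarith
  have hsub : ∀ B {s t : ℝ≥0}, s ≤ t → ∀ F, MeasurableSet[ℱ s] F →
      ∫ ω in F, h B (X s ω) ∂P ≤ ∫ ω in F, h B (X t ω) ∂P := by
    intro B s t hst F hF
    by_cases hB : B ∈ D
    · simp only [hh, dif_pos hB]
      refine hX.setIntegral_mono hc ha (C := 1) (fun i => ?_) (fun t ω i => ?_) hst hF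
      · rw [abs_of_nonneg (blockFun_nonneg hκ0.le _ _)]
        exact blockFun_le_one hκ0.le hκ1.le _ _
      · exact killedGen_blockFun_nonneg hc (fun i j hj => ha.bounds t ω i j hj)
          hB.choose_spec.1 i
    · simp [hh, dif_neg hB]
  -- `n(n+1)` steps of mesh `1/(n+1)` reach time `n`, so horizon and resolution grow together.
  set E : ℕ → Set Ω := fun n => {ω | (visitState A D (blockCenter l) m
    (fun k => X ((k : ℝ≥0) / (n + 1)) ω) (n * (n + 1))).IsDone m} with hE
  have hEle : ∀ n, P (E n) ≤ ENNReal.ofReal ((1 - p) ^ (m - 1)) := by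
    intro n
    have hgrid : ∀ {j k : ℕ}, j ≤ k → (j : ℝ≥0) / (n + 1) ≤ (k : ℝ≥0) / (n + 1) := by
      intro j k hjk
      gcongr
    have := measure_isDone_le (P := P) (A := A) (Q := (1 - p)⁻¹)
      (𝒢 := fun k => ℱ ((k : ℝ≥0) / (n + 1)))
      (Y := fun k => X ((k : ℝ≥0) / (n + 1)))
      (one_le_inv_iff₀.2 ⟨by linarith, by linarith⟩) h0 h1 hoff hon hm (fun k => ℱ.le _)
      (fun j k hjk => ℱ.mono (hgrid hjk)) (fun k => hX.adapted _)
      (fun k B F hF => hsub B (hgrid k.le_succ) F hF) (n * (n + 1))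
    rwa [inv_inv] at this
  have hsubset : exitsBefore X A (r * l) ≤ᵐ[P] ⋃ N, ⋂ n ≥ N, E n := by
    filter_upwards [hX.ae_jump_mem_nbrs hc ha, hX.start] with ω hjump hstart hω
    obtain ⟨τ, hτ, hτA⟩ := exists_of_mem_exitsBefore (hX.right_cont ω) hω
    have hreach := reachableIn_path (l := l) (hX.right_cont ω) (hX.left_lim ω) hjump hstart τ
    obtain ⟨F, hF, hFB⟩ := exists_visited_blocks hr hA hτ hreach
      (by rintro B ⟨s, -, rfl⟩; exact blockCenter_mem_renLattice _ _)
    have hmF : m ≤ F.card := by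
      have : (m : ℝ) < F.card + 1 := by linarith
      exact Nat.lt_succ_iff.1 (by exact_mod_cast this)
    have hev := eventually_isDone (hX.right_cont ω) (D := D) (b := blockCenter l) hτA
      (fun B hB => (hFB B hB).2) (fun B hB => (hFB B hB).1) hmF
    obtain ⟨N, hN⟩ := eventually_atTop.1 hev
    exact Set.mem_iUnion.2 ⟨N, Set.mem_iInter₂.2 fun n hn => hN n hn⟩
  refine (measure_mono_ae hsubset).trans ?_
  -- The exit event lies almost surely in the lower limit of the `E n`, an increasing union of sets
  -- each contained in some `E N`.
  rw [Monotone.measure_iUnion fun M N hMN =>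
    Set.biInter_subset_biInter_left fun n (hn : n ≥ N) => (hMN.trans hn : M ≤ n)]
  exact iSup_le fun N => (measure_mono (Set.biInter_subset_of_mem le_rfl)).trans (hEle N)

/-- The rate of decay of the exit probability. -/
noncomputable def exitRate (ε : ℝ) (l : ℕ) (c : ℝ) : ℝ :=
  -(ε * Real.log (1 - ((1 + 4 * c ^ 2)⁻¹) ^ (4 * l))) / (2 * l)

lemma one_sub_pow_mem_Ioo {l : ℕ} (hl : 1 ≤ l) {c : ℝ} (hc : 1 ≤ c) :
    1 - ((1 + 4 * c ^ 2)⁻¹) ^ (4 * l) ∈ Set.Ioo (0 : ℝ) 1 := by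
  have hκ0 : 0 < (1 + 4 * c ^ 2)⁻¹ := by positivity
  have hκ1 : (1 + 4 * c ^ 2)⁻¹ < 1 := inv_lt_one_of_one_lt₀ (by nlinarith)
  have h1 : ((1 + 4 * c ^ 2)⁻¹) ^ (4 * l) < 1 := pow_lt_one₀ hκ0.le hκ1 (by omega)
  have h2 : 0 < ((1 + 4 * c ^ 2)⁻¹) ^ (4 * l) := by positivity
  exact ⟨by linarith, by linarith⟩

lemma exitRate_pos {ε : ℝ} (hε : 0 < ε) {l : ℕ} (hl : 1 ≤ l) {c : ℝ} (hc : 1 ≤ c) :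
    0 < exitRate ε l c := by
  obtain ⟨h0, h1⟩ := one_sub_pow_mem_Ioo hl hc
  have hlog := Real.log_neg h0 h1
  have hl' : (0 : ℝ) < l := by exact_mod_cast hl
  exact div_pos (by nlinarith) (by positivity)

lemma IsKilledWalk.measure_exitsBefore_le_exp {A : Set (ℤ × ℤ)}
    {a : ℝ≥0 → Ω → ℤ × ℤ → ℤ × ℤ → ℝ} {X : ℝ≥0 → Ω → ℤ × ℤ} {c : ℝ} {ℱ : Filtration ℝ≥0 mΩ}
    {P : Measure Ω} [IsProbabilityMeasure P] (hX : IsKilledWalk A a 0 ℱ X P) (hc : 1 ≤ c)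
    (ha : EllipticRates c a) {l : ℕ} (hl : 1 ≤ l) {r ε : ℝ} (hε : 0 < ε) (hr : 4 / ε ≤ r)
    (hA : IsDirty l r ε A) :
    P (exitsBefore X A (r * l)) ≤ ENNReal.ofReal (Real.exp (-exitRate ε l c * (r * l))) := by
  have hr0 : 0 ≤ r := (by positivity : 0 ≤ 4 / ε).trans hr
  have hεr : 4 ≤ ε * r := by rw [div_le_iff₀ hε] at hr; linarith
  obtain ⟨h0, h1⟩ := one_sub_pow_mem_Ioo hl hc
  have hceil : 2 < ⌈ε * r⌉₊ := Nat.lt_ceil.2 (by norm_num; linarith)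
  have hlt : ((⌈ε * r⌉₊ - 1 : ℕ) : ℝ) < ε * r := Nat.lt_ceil.1 (by omega)
  refine (hX.measure_exitsBefore_le hc ha hl (m := ⌈ε * r⌉₊ - 1) (by omega) hr0 hA hlt).trans
    (ENNReal.ofReal_le_ofReal ?_)
  rw [← Real.log_le_iff_le_exp (pow_pos h0 _), Real.log_pow]
  have hl' : (0 : ℝ) < l := by exact_mod_cast hl
  have hlog := Real.log_neg h0 h1
  -- One unit is lost because `m < εr` must be strict and one in the exponent `m - 1`; `εr - 2 ≥
  -- εr/2` because `εr ≥ 4`. This explains the `2` in `exitRate`.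
  have hk : ε * r / 2 ≤ ((⌈ε * r⌉₊ - 1 - 1 : ℕ) : ℝ) := by
    have := Nat.le_ceil (ε * r)
    have h2 : ((⌈ε * r⌉₊ : ℕ) : ℝ) = ((⌈ε * r⌉₊ - 1 - 1 : ℕ) : ℝ) + 2 := by
      exact_mod_cast (by omega : ⌈ε * r⌉₊ = ⌈ε * r⌉₊ - 1 - 1 + 2)
    linarith
  have hrate : -exitRate ε l c * (r * l) =
      ε * r / 2 * Real.log (1 - ((1 + 4 * c ^ 2)⁻¹) ^ (4 * l)) := by
    unfold exitRate
    field_simp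
  rw [hrate]
  exact mul_le_mul_of_nonpos_right hk hlog.le

/-! ### Ellipticity of the rates in the Helffer–Sjöstrand walk -/

lemma continuous_extendZero {A : Set (ℤ × ℤ)} {φ : ℝ≥0 → ↥Aᶜ → ℝ} (hφ : Continuous φ)
    (i : ℤ × ℤ) : Continuous fun t => extendZero A (φ t) i := by
  by_cases hi : i ∈ Aᶜ
  · have : (fun t => extendZero A (φ t) i) = fun t => φ t ⟨i, hi⟩ := by
      ext t
      exact Subtype.val_injective.extend_apply (φ t) 0 (⟨i, hi⟩ : ↥Aᶜ)
    rw [this]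
    exact (continuous_apply _).comp hφ
  · have : (fun t => extendZero A (φ t) i) = fun _ => 0 := by
      ext t
      exact Function.extend_apply' _ _ _ fun ⟨x, hx⟩ => hi (hx ▸ x.2)
    rw [this]
    exact continuous_const

lemma ellipticRates_hessian {V : ℝ → ℝ} (hV : ContDiff ℝ (⊤ : ℕ∞) V) {c : ℝ}
    (hb : ∀ t, 1 / c ≤ iteratedDeriv 2 V t ∧ iteratedDeriv 2 V t ≤ c) {A : Set (ℤ × ℤ)}
    {Φ : ℝ≥0 → Ω → (↥Aᶜ → ℝ)} (hΦ : ∀ ω, Continuous fun t => Φ t ω) :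
    EllipticRates c (fun t ω i j =>
      iteratedDeriv 2 V (extendZero A (Φ t ω) i - extendZero A (Φ t ω) j)) where
  measurable ω i j := ((hV.continuous_iteratedDeriv 2 (WithTop.coe_le_coe.2 (le_top : ((2 : ℕ) : ℕ∞) ≤ ⊤))).comp
    ((continuous_extendZero (hΦ ω) i).sub (continuous_extendZero (hΦ ω) j))).measurable
  bounds _ _ _ _ _ := hb _

end PinnedField

open PinnedField
theorem proposition2 (ε : ℝ) (hε0 : 0 < ε) (hε1 : ε < 1) :
    ∃ r₀ : ℝ, ∀ l : ℕ, 1 ≤ l → ∀ cV : ℝ, 1 ≤ cV → ∃ c₃ : ℝ, 0 < c₃ ∧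
      ∀ r : ℝ, r₀ ≤ r → ∀ A : Set (ℤ × ℤ), IsDirty l r ε A →
        -- the Helffer-Sjostrand walk, for every potential and every initial field
        (Aᶜ.Finite → ∀ V : ℝ → ℝ, ContDiff ℝ (⊤ : ℕ∞) V → (∀ t, V (-t) = V t) →
          (∀ t, 1 / cV ≤ iteratedDeriv 2 V t ∧ iteratedDeriv 2 V t ≤ cV) →
          ∀ φ : ↥Aᶜ → ℝ,
          ∀ (Ω : Type*) (mΩ : MeasurableSpace Ω) (P : Measure Ω), IsProbabilityMeasure P →
          ∀ (X : ℝ≥0 → Ω → ℤ × ℤ) (Φ : ℝ≥0 → Ω → (↥Aᶜ → ℝ)), IsHSProcess V A 0 φ X Φ P →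
            P (exitsBefore X A (r * l)) ≤ ENNReal.ofReal (Real.exp (-c₃ * (r * l)))) ∧
        -- every time-inhomogeneous walk with deterministic rates within the bounds
        (∀ a : ℝ≥0 → ℤ × ℤ → ℤ × ℤ → ℝ, (∀ i j, Measurable fun t => a t i j) →
          (∀ t i, ∀ j ∈ nbrs i, 1 / cV ≤ a t i j ∧ a t i j ≤ cV) →
          ∀ (Ω : Type*) (mΩ : MeasurableSpace Ω) (P : Measure Ω), IsProbabilityMeasure P →
          ∀ (ℱ : Filtration ℝ≥0 mΩ) (X : ℝ≥0 → Ω → ℤ × ℤ),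
            IsKilledWalk A (fun t _ => a t) 0 ℱ X P →
            P (exitsBefore X A (r * l)) ≤ ENNReal.ofReal (Real.exp (-c₃ * (r * l)))) := by
  -- The threshold `4/ε` ensures `εr ≥ 4`, which absorbs the rounding losses independently of `l`
  -- and `cV`.
  refine ⟨4 / ε, fun l hl cV hcV => ⟨exitRate ε l cV, exitRate_pos hε0 hl hcV,
    fun r hr A hA => ⟨?_, ?_⟩⟩⟩
  · intro _ V hV _ hb φ Ω mΩ P _ X Φ h
    obtain ⟨ℱ, -, hX⟩ := h.walk
    exact hX.measure_exitsBefore_le_exp hcV (ellipticRates_hessian hV hb h.langevin.continuous_paths)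
      hl hε0 hr hA
  · intro a ha hb Ω mΩ P _ ℱ X hX
    exact hX.measure_exitsBefore_le_exp hcV ⟨fun _ i j => ha i j, fun t _ i j hj => hb t i j hj⟩
      hl hε0 hr hA
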